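/- All graphs are finite and simple. A \emph{queue layout} of a graph $G$ with $k$ queues consists of a linear order $\prec$ of the vertices of $G$ and a partition of the edges of $G$ into $k$ (possibly empty) classes, called queues, such that no queue contains two nested edges, that is, edges $ab$ and $cd$ with $a \prec c \prec d \prec b$. The \emph{queue number} of $G$ is the smallest $k$ for which $G$ has a queue layout with $k$ queues. A \emph{planar 3-tree} is a triangulated plane graph $G$ (every face, including the outer face, is bounded by a triangle) with $n \ge 3$ vertices such that either $n = 3$ and $G$ is a 3-cycle, or $n > 3$ and $G$ has a vertex whose deletion gives a planar 3-tree with $n-1$ vertices. \textbf{Theorem.} Every planar 3-tree has queue number at most $5$. -/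

import Mathlib

universe u

namespace SimpleGraph

/-- A combinatorial embedding of `G` in an oriented surface: `next` sends a dart (oriented edge)
to the next dart in clockwise order around the same source vertex. The cycles of `next` are
exactly the sets of darts with a common source. -/
structure RotationSystem {V : Type u} (G : SimpleGraph V) where
  next : Equiv.Perm G.Dart
  sameCycle_iff : ∀ d e : G.Dart, next.SameCycle d e ↔ d.fst = e.fst

namespace RotationSystem

variable {V : Type u} {G : SimpleGraph V}

/-- The step along the boundary walk of a face: traverse the dart `u → v`, then leave `v` by the
dart that follows `v → u` in the rotation at `v`. -/
def faceNext (R : RotationSystem G) : Equiv.Perm G.Dart :=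
  (Dart.symm_involutive (G := G)).toPerm.trans R.next

/-- The faces of the embedding of a graph without isolated vertices: the orbits of `faceNext`. -/
def Face (R : RotationSystem G) : Type u :=
  Quotient (Equiv.Perm.SameCycle.setoid R.faceNext)

/-- The embedding of a (finite, connected, with an edge) graph is an embedding in the sphere,
equivalently in the plane: Euler's formula `|V| - |E| + |F| = 2` holds, i.e. the genus is `0`. -/
def IsPlane (R : RotationSystem G) : Prop :=
  G.Connected ∧ (Nat.card V : ℤ) - (Nat.card G.edgeSet : ℤ) + (Nat.card R.Face : ℤ) = 2

/-- Every face (the outer one included) is bounded by a closed walk of length `3`. -/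
def IsTriangulated (R : RotationSystem G) : Prop :=
  ∀ d : G.Dart, Function.minimalPeriod R.faceNext d = 3

end RotationSystem

/-- `G` is a finite graph with at least three vertices that can be embedded in the plane as a
triangulated plane graph. -/
def IsPlaneTriangulation {V : Type u} (G : SimpleGraph V) : Prop :=
  3 ≤ Nat.card V ∧ ∃ R : RotationSystem G, R.IsPlane ∧ R.IsTriangulated

/-- A planar 3-tree is a triangulated plane graph with `n ≥ 3` vertices that is a 3-cycle if
`n = 3`, and that has a vertex whose deletion gives a planar 3-tree if `n > 3`.
(The 3-cycle is a triangulated plane graph, so this need not be demanded in the first case.) -/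
inductive IsPlanarThreeTree : {V : Type u} → SimpleGraph V → Prop
  | triangle {V : Type u} (G : SimpleGraph V) (card_eq : Nat.card V = 3) (eq_top : G = ⊤) :
      IsPlanarThreeTree G
  | step {V : Type u} (G : SimpleGraph V) (lt_card : 3 < Nat.card V)
      (triangulation : G.IsPlaneTriangulation) (v : V)
      (delete : IsPlanarThreeTree (G.induce ({v}ᶜ : Set V))) :
      IsPlanarThreeTree G

/-- A `k`-queue layout of `G`: a linear order of the vertices and a partition of the edges into
`k` (possibly empty) queues such that no two edges of the same queue are nested. Edges `ab` and
`cd` with `a < c < d < b` are nested (and have no common endvertex). -/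
structure QueueLayout {V : Type u} (G : SimpleGraph V) (k : ℕ) where
  order : LinearOrder V
  queue : G.edgeSet → Fin k
  not_nested : ∀ (a b c d : V) (hab : G.Adj a b) (hcd : G.Adj c d),
    order.lt a c → order.lt c d → order.lt d b →
      queue ⟨s(a, b), hab⟩ ≠ queue ⟨s(c, d), hcd⟩

/-- The smallest number of queues in a queue layout of `G` (`⊤` if no finite number suffices). -/
noncomputable def queueNumber {V : Type u} (G : SimpleGraph V) : ℕ∞ :=
  ⨅ (k : ℕ) (_ : Nonempty (QueueLayout G k)), (k : ℕ∞)

end SimpleGraph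

/-! A planar 3-tree arises from a triangle by repeatedly putting a vertex of degree three into a
face. Its vertices are arranged in layers: each component of a layer beyond the first lies inside a
triangle of a component of the layer before, the face around it. A component is drawn on levels so
that each of its triangles has its corners on three consecutive levels `s`, `s + 1`, `s + 2`, and so
that triangles with the same `s` are ordered consistently with their `i`-th corners, for each `i`
(`CompFace.mono`).

The code of a vertex is the code of the face around its component, followed by its level and
position there. Codes are ordered by length, then lexicographically. A strict inequality between the
`i`-th corners of two triangles then forces the same inequality between the triangles
(`IsFace.mono`). An edge inside a component joins the lowest corner of some triangle to the middle
or to the top one, which gives two queues. An edge to the next layer starts at the `i`-th corner of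
the surrounding face, which gives three more. Nesting within any of the five contradicts
monotonicity (`InQueue.not_nested`).

No drawing is fitted to a given graph. There is one infinite universal component, whose slots are
rational intervals that can be subdivided forever. A triangular face of the graph carries a set of
free codes, and any such region splits at a new vertex into three disjoint ones (`IsRegion.splits`).
Counting edges with Euler's formula shows that the deleted vertex has degree three; its deletion
leaves a triangulated rotation system, so codes are assigned by induction (`nonempty_stacking`). -/

namespace SimpleGraph

namespace ThreeTree

/-! ### Edge slots: the triangles stacked on one side of an edge -/

/-- A triangular face of a component: it has corners `(level + i, corner i)` for `i = 0, 1, 2`, and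
the vertices inside it are placed according to `(level, pos)`. -/
structure Face where
  level : ℕ
  pos : ℚ
  corner : Fin 3 → ℚ

/-- An edge of a component together with an empty side of it: the lower end is `(level, lo)`, the
upper end is one level (or two levels, if `long`) higher at `hi`. The vertices on the side get
positions between `near` and `far`, where `near` is closer to the upper end. -/
structure EdgeSlot where
  level : ℕ
  lo : ℚ
  hi : ℚ
  long : Bool
  near : ℚ
  far : ℚ

namespace EdgeSlot

/-- The position of the apex of the triangle on the edge. -/
def apex (e : EdgeSlot) : ℚ := (2 * e.near + e.far) / 3

/-- The second of two positions for the triangle on the edge. -/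
def apex' (e : EdgeSlot) : ℚ := (e.near + 2 * e.far) / 3

/-- The triangle on the edge, with a given position. -/
def face (e : EdgeSlot) (x : ℚ) : Face :=
  ⟨e.level, x, if e.long then ![e.lo, e.apex, e.hi] else ![e.lo, e.hi, e.apex]⟩

/-- The edge between the lower end and the apex. -/
def lower (e : EdgeSlot) : EdgeSlot := ⟨e.level, e.lo, e.apex, !e.long, e.apex', e.far⟩

/-- The edge between the upper end and the apex. -/
def upper (e : EdgeSlot) : EdgeSlot :=
  if e.long then ⟨e.level + 1, e.apex, e.hi, false, e.near, e.apex⟩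
  else ⟨e.level + 1, e.hi, e.apex, false, e.apex, e.near⟩

/-- The number of levels between the ends. -/
def span (e : EdgeSlot) : ℕ := if e.long then 2 else 1

/-- The upper end lies on the near side of the free positions. -/
def Wf (e : EdgeSlot) : Prop :=
  (e.near < e.far ∧ e.hi ≤ e.near) ∨ (e.far < e.near ∧ e.near ≤ e.hi)

/-- The faces that arise in an edge slot. -/
inductive FaceIn : EdgeSlot → Face → Prop
  | here (e : EdgeSlot) : FaceIn e (e.face e.apex)
  | here' (e : EdgeSlot) : FaceIn e (e.face e.apex')
  | ofLower {e : EdgeSlot} {f : Face} (h : FaceIn e.lower f) : FaceIn e f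
  | ofUpper {e : EdgeSlot} {f : Face} (h : FaceIn e.upper f) : FaceIn e f

theorem Wf.lower {e : EdgeSlot} (h : e.Wf) : e.lower.Wf := by
  simp only [Wf, EdgeSlot.lower, apex, apex'] at *
  rcases h with h | h
  · left; constructor <;> linarith
  · right; constructor <;> linarith

theorem Wf.upper {e : EdgeSlot} (h : e.Wf) : e.upper.Wf := by
  obtain ⟨s, lo, hi, long, p, q⟩ := e
  cases long <;> simp only [Wf, EdgeSlot.upper, apex] at * <;> rcases h with h | h
  · right; simp; linarith
  · left; simp; linarith
  · left; constructor <;> simp <;> linarith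
  · right; constructor <;> simp <;> linarith

end EdgeSlot

/-- `x` lies strictly between `p` and `q`, in either order. -/
def Btw (p q x : ℚ) : Prop := (p < x ∧ x < q) ∨ (q < x ∧ x < p)

namespace EdgeSlot

/-- This is the invariant behind all comparisons of slots: whatever grows in the slot stays in its
interval, apart from the two ends of the edge, which occur as corners only on their own levels. -/
theorem FaceIn.bounds {e : EdgeSlot} {f : Face} (h : FaceIn e f) (he : e.Wf) :
    e.level ≤ f.level ∧ Btw e.near e.far f.pos ∧ (f.level = e.level → f.corner 0 = e.lo) ∧
      ∀ i : Fin 3, e.level < f.level + i →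
        (f.level + i = e.level + e.span ∧ f.corner i = e.hi) ∨
          Btw e.near e.far (f.corner i) := by
  induction h with
  | here e =>
    obtain ⟨s, lo, hi, long, p, q⟩ := e
    have hb : Btw p q ((2 * p + q) / 3) := by
      rcases he with h | h <;> simp only at h
      · left; constructor <;> linarith
      · right; constructor <;> linarith
    refine ⟨le_rfl, hb, ?_, ?_⟩
    · cases long <;> simp [face]
    · intro i
      cases long <;> fin_cases i <;> simp [face, span, apex, hb]
  | here' e =>
    obtain ⟨s, lo, hi, long, p, q⟩ := e
    have hb : Btw p q ((2 * p + q) / 3) := by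
      rcases he with h | h <;> simp only at h
      · left; constructor <;> linarith
      · right; constructor <;> linarith
    have hb' : Btw p q ((p + 2 * q) / 3) := by
      rcases he with h | h <;> simp only at h
      · left; constructor <;> linarith
      · right; constructor <;> linarith
    refine ⟨le_rfl, hb', ?_, ?_⟩
    · cases long <;> simp [face]
    · intro i
      cases long <;> fin_cases i <;> simp [face, span, apex, hb]
  | @ofLower e f _ ih =>
    obtain ⟨h1, h2, h3, h4⟩ := ih he.lower
    have key : ∀ x, Btw e.lower.near e.lower.far x → Btw e.near e.far x := by
      intro x hx
      simp only [Btw, EdgeSlot.lower, apex'] at *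
      rcases he with h | h <;> rcases hx with hx | hx
      · left; constructor <;> linarith
      · exfalso; linarith
      · exfalso; linarith
      · right; constructor <;> linarith
    refine ⟨h1, key _ h2, h3, fun i hi => ?_⟩
    rcases h4 i hi with h | h
    · right
      rw [h.2]
      simp only [Btw, EdgeSlot.lower, apex]
      rcases he with h | h
      · left; constructor <;> linarith
      · right; constructor <;> linarith
    · exact Or.inr (key _ h)
  | @ofUpper e f _ ih =>
    obtain ⟨h1, h2, h3, h4⟩ := ih he.upper
    obtain ⟨s, lo, hi, long, p, q⟩ := e
    have hb : Btw p q ((2 * p + q) / 3) := by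
      rcases he with h | h <;> simp only at h
      · left; constructor <;> linarith
      · right; constructor <;> linarith
    have key : ∀ x, Btw (upper ⟨s, lo, hi, long, p, q⟩).near (upper ⟨s, lo, hi, long, p, q⟩).far x →
        Btw p q x := by
      intro x hx
      cases long <;> simp only [Btw, EdgeSlot.upper, apex, Wf] at * <;> simp at hx <;>
      rcases he with h | h <;> rcases hx with hx | hx <;> first
        | (exfalso; linarith)
        | (left; constructor <;> linarith)
        | (right; constructor <;> linarith)
    have hl : (upper ⟨s, lo, hi, long, p, q⟩).level = s + 1 := by cases long <;> rfl
    rw [hl] at h1 h3 h4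
    refine ⟨by simp only; omega, key _ h2, fun h => by simp only at h; omega, fun i hi' => ?_⟩
    by_cases hi0 : s + 1 < f.level + i
    · rcases h4 i hi0 with h | h
      · cases long
        · right; rw [h.2]; exact hb
        · left; refine ⟨?_, h.2⟩
          rw [h.1]; simp [span, EdgeSlot.upper]
      · exact Or.inr (key _ h)
    -- Only the lowest corner can fail to lie above the level of the upper edge. It is then the
    -- lower end of that edge: `hi` if the given edge is short, the apex if it is long.
    · have hi1 : i = 0 := by
        apply Fin.ext; simp only [Fin.val_zero]; omega
      subst hi1
      have hf : f.level = s + 1 := by simp at hi0; omega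
      have h5 := h3 hf
      cases long
      · left; exact ⟨by simp [hf, span], h5⟩
      · right; rw [h5]; exact hb

end EdgeSlot

/-- Of two faces on the same level, the corners are in the same order as the faces. -/
def Face.Mono (f f' : Face) : Prop :=
  f.level = f'.level → f.pos ≤ f'.pos → ∀ i, f.corner i ≤ f'.corner i

namespace EdgeSlot

/-- On the common level both triangles have lowest corner `lo`. The other corners of `f` are the
apex or lie beyond `apex'`, while those of the triangle on the edge are `hi` and the apex, and `Wf`
puts `hi` on the near side of the apex. The orientation of the slot decides which of the two claims
has content. -/
theorem mono_here_lower {e : EdgeSlot} (he : e.Wf) {x : ℚ} (hx : x = e.apex ∨ x = e.apex')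
    {f : Face} (hf : FaceIn e.lower f) : (e.face x).Mono f ∧ f.Mono (e.face x) := by
  obtain ⟨-, h2, h3, h4⟩ := hf.bounds he.lower
  obtain ⟨s, lo, hi, long, p, q⟩ := e
  have hc : f.level = s → (f.corner 1 = (2 * p + q) / 3 ∨ Btw ((p + 2 * q) / 3) q (f.corner 1)) ∧
      (f.corner 2 = (2 * p + q) / 3 ∨ Btw ((p + 2 * q) / 3) q (f.corner 2)) := by
    intro h
    constructor
    · rcases h4 1 (by simp [lower, h]) with h | h
      · exact Or.inl h.2
      · exact Or.inr h
    · rcases h4 2 (by simp [lower, h]) with h | h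
      · exact Or.inl h.2
      · exact Or.inr h
  simp only [lower, apex, apex', Btw, Wf] at *
  constructor
  · intro hl hp i
    have hl' : f.level = s := hl.symm
    obtain ⟨c1, c2⟩ := hc hl'
    have c0 := h3 hl'
    simp only [face] at hp
    cases long <;> fin_cases i <;> simp [face, c0, apex] <;> grind
  · intro hl hp i
    have hl' : f.level = s := hl
    obtain ⟨c1, c2⟩ := hc hl'
    have c0 := h3 hl'
    simp only [face] at hp
    cases long <;> fin_cases i <;> simp [face, c0, apex] <;> grind

/-- There is nothing to compare: triangles over the upper edge start at least one level higher. -/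
theorem mono_here_upper {e : EdgeSlot} (he : e.Wf) {x : ℚ}
    {f : Face} (hf : FaceIn e.upper f) : (e.face x).Mono f ∧ f.Mono (e.face x) := by
  obtain ⟨h1, -⟩ := hf.bounds he.upper
  have hl : e.upper.level = e.level + 1 := by
    obtain ⟨s, lo, hi, long, p, q⟩ := e; cases long <;> rfl
  have : (e.face x).level = e.level := rfl
  constructor <;> intro h <;> omega

/-- The apex separates the two families. On a common level, which lies above `lo`, all corners over
the upper edge are on the near side of the apex or equal to it, and all corners over the lower edge
are on the far side or equal to it. -/
theorem mono_lower_upper {e : EdgeSlot} (he : e.Wf) {f f' : Face}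
    (hf : FaceIn e.lower f) (hf' : FaceIn e.upper f') : f.Mono f' ∧ f'.Mono f := by
  obtain ⟨h1, h2, h3, h4⟩ := hf.bounds he.lower
  obtain ⟨h1', h2', h3', h4'⟩ := hf'.bounds he.upper
  have hl : e.upper.level = e.level + 1 := by
    obtain ⟨s, lo, hi, long, p, q⟩ := e; cases long <;> rfl
  rw [hl] at h1' h3' h4'
  have hc : f.level = f'.level → ∀ i, (f.corner i = e.apex ∨ Btw e.apex' e.far (f.corner i)) := by
    intro h i
    rcases h4 i (by have : e.lower.level = e.level := rfl
                    omega) with h | h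
    · exact Or.inl h.2
    · exact Or.inr h
  have hc' : ∀ i, (f'.corner i = e.hi ∨ f'.corner i = e.apex ∨
      Btw e.near e.apex (f'.corner i)) := by
    intro i
    obtain ⟨s, lo, hi, long, p, q⟩ := e
    by_cases hi' : s + 1 < f'.level + i
    · rcases h4' i hi' with h | h
      · cases long
        · exact Or.inr (Or.inl h.2)
        · exact Or.inl h.2
      · cases long
        · exact Or.inr (Or.inr (Or.symm h))
        · exact Or.inr (Or.inr h)
    · simp only at h1'
      have h0 : i = 0 := by apply Fin.ext; simp only [Fin.val_zero]; omega
      subst h0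
      have := h3' (by simp at hi' ⊢; omega)
      cases long
      · exact Or.inl this
      · exact Or.inr (Or.inl this)
  have hp' : Btw e.near e.apex f'.pos := by
    obtain ⟨s, lo, hi, long, p, q⟩ := e
    cases long
    · exact Or.symm h2'
    · exact h2'
  obtain ⟨s, lo, hi, long, p, q⟩ := e
  simp only [lower, apex, apex', Btw, Wf] at *
  constructor
  · intro hl hp i
    have := hc hl i
    have := hc' i
    grind
  · intro hl hp i
    have := hc hl.symm i
    have := hc' i
    grind

theorem FaceIn.mono {e : EdgeSlot} {f f' : Face} (h : FaceIn e f) (h' : FaceIn e f')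
    (he : e.Wf) : f.Mono f' := by
  induction h generalizing f' with
  | here e =>
    cases h' with
    | here | here' => exact fun _ _ _ => le_rfl
    | ofLower h => exact (mono_here_lower he (Or.inl rfl) h).1
    | ofUpper h => exact (mono_here_upper he h).1
  | here' e =>
    cases h' with
    | here | here' => exact fun _ _ _ => le_rfl
    | ofLower h => exact (mono_here_lower he (Or.inr rfl) h).1
    | ofUpper h => exact (mono_here_upper he h).1
  | @ofLower e f h ih =>
    cases h' with
    | here => exact (mono_here_lower he (Or.inl rfl) h).2
    | here' => exact (mono_here_lower he (Or.inr rfl) h).2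
    | ofLower h' => exact ih h' he.lower
    | ofUpper h' => exact (mono_lower_upper he h h').1
  | @ofUpper e f h ih =>
    cases h' with
    | here => exact (mono_here_upper he h).2
    | here' => exact (mono_here_upper he h).2
    | ofLower h' => exact (mono_lower_upper he h' h).2
    | ofUpper h' => exact ih h' he.upper

end EdgeSlot

/-! ### Vertex slots and the universal component -/

/-- A vertex `(level, base)` of a component, together with an interval of free positions. -/
structure VertexSlot where
  level : ℕ
  base : ℚ
  left : ℚ
  right : ℚ

namespace VertexSlot

/-- The position of the neighbour of the base in the slot. -/
def apex (v : VertexSlot) : ℚ := (2 * v.left + v.right) / 3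

/-- The right end of the free positions above the apex. -/
def apex' (v : VertexSlot) : ℚ := (v.left + 2 * v.right) / 3

/-- The left side of the edge between the base and the apex. -/
def leftSide (v : VertexSlot) : EdgeSlot := ⟨v.level, v.base, v.apex, false, v.apex, v.left⟩

/-- The right side of the edge between the base and the apex. -/
def rightSide (v : VertexSlot) : EdgeSlot := ⟨v.level, v.base, v.apex, false, v.apex', v.right⟩

/-- The slot above the apex. -/
def up (v : VertexSlot) : VertexSlot := ⟨v.level + 1, v.apex, v.apex, v.apex'⟩

/-- The faces that arise in a vertex slot. -/
inductive FaceIn : VertexSlot → Face → Prop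
  | ofLeft {v : VertexSlot} {f : Face} (h : v.leftSide.FaceIn f) : FaceIn v f
  | ofRight {v : VertexSlot} {f : Face} (h : v.rightSide.FaceIn f) : FaceIn v f
  | ofUp {v : VertexSlot} {f : Face} (h : FaceIn v.up f) : FaceIn v f

theorem wf_leftSide {v : VertexSlot} (h : v.left < v.right) : v.leftSide.Wf := by
  right; simp only [leftSide, apex]; constructor <;> linarith

theorem wf_rightSide {v : VertexSlot} (h : v.left < v.right) : v.rightSide.Wf := by
  left; simp only [rightSide, apex, apex']; constructor <;> linarith

theorem wf_up {v : VertexSlot} (h : v.left < v.right) : v.up.left < v.up.right := by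
  simp only [up, apex, apex']; linarith

theorem FaceIn.bounds {v : VertexSlot} {f : Face} (h : FaceIn v f) (hv : v.left < v.right) :
    v.level ≤ f.level ∧ (v.left < f.pos ∧ f.pos < v.right) ∧
      (f.level = v.level → f.corner 0 = v.base) ∧
      ∀ i : Fin 3, v.level < f.level + i → v.left < f.corner i ∧ f.corner i < v.right := by
  induction h with
  | @ofLeft v f h =>
    obtain ⟨h1, h2, h3, h4⟩ := h.bounds (wf_leftSide hv)
    simp only [leftSide, Btw, apex] at *
    refine ⟨h1, by grind, h3, fun i hi => ?_⟩
    have := h4 i hi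
    grind
  | @ofRight v f h =>
    obtain ⟨h1, h2, h3, h4⟩ := h.bounds (wf_rightSide hv)
    simp only [rightSide, Btw, apex, apex'] at *
    refine ⟨h1, by grind, h3, fun i hi => ?_⟩
    have := h4 i hi
    grind
  | @ofUp v f h ih =>
    obtain ⟨h1, h2, h3, h4⟩ := ih (wf_up hv)
    simp only [up, apex, apex'] at *
    refine ⟨by omega, by grind, by omega, fun i hi => ?_⟩
    by_cases hi' : v.level + 1 < f.level + i
    · have := h4 i hi'
      grind
    · have h0 : i = 0 := by apply Fin.ext; simp only [Fin.val_zero]; omega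
      subst h0
      have := h3 (by simp at hi' ⊢; omega)
      grind

/-- On the level of the base both triangles have the base as lowest corner. All higher corners lie
weakly on their own sides of the apex. The positions of the triangles rule out the reverse order. -/
theorem mono_left_right {v : VertexSlot} (hv : v.left < v.right) {f f' : Face}
    (hf : v.leftSide.FaceIn f) (hf' : v.rightSide.FaceIn f') : f.Mono f' ∧ f'.Mono f := by
  obtain ⟨h1, h2, h3, h4⟩ := hf.bounds (wf_leftSide hv)
  obtain ⟨h1', h2', h3', h4'⟩ := hf'.bounds (wf_rightSide hv)
  simp only [leftSide, rightSide, Btw, apex, apex'] at *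
  have key : f.level = f'.level → ∀ i, f.corner i ≤ f'.corner i := by
    intro hl i
    by_cases hi' : v.level < f.level + i
    · have := h4 i hi'
      have := h4' i (hl ▸ hi')
      grind
    · have h0 : i = 0 := by apply Fin.ext; simp only [Fin.val_zero]; omega
      subst h0
      have hl' : f.level = v.level := by simp at hi'; omega
      rw [h3 hl', h3' (hl ▸ hl')]
  refine ⟨fun hl _ => key hl, fun hl hp => ?_⟩
  grind

theorem mono_left_up {v : VertexSlot} (hv : v.left < v.right) {f f' : Face}
    (hf : v.leftSide.FaceIn f) (hf' : v.up.FaceIn f') : f.Mono f' ∧ f'.Mono f := by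
  obtain ⟨h1, h2, h3, h4⟩ := hf.bounds (wf_leftSide hv)
  obtain ⟨h1', h2', h3', h4'⟩ := hf'.bounds (wf_up hv)
  simp only [leftSide, up, Btw, apex, apex'] at *
  have key : f.level = f'.level → ∀ i, f.corner i ≤ f'.corner i := by
    intro hl i
    have := h4 i (by omega)
    by_cases hi' : v.level + 1 < f'.level + i
    · have := h4' i hi'
      grind
    · have h0 : i = 0 := by apply Fin.ext; simp only [Fin.val_zero]; omega
      subst h0
      have := h3' (by simp at hi'; omega)
      grind
  refine ⟨fun hl _ => key hl, fun hl hp => ?_⟩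
  grind

theorem mono_up_right {v : VertexSlot} (hv : v.left < v.right) {f f' : Face}
    (hf : v.up.FaceIn f) (hf' : v.rightSide.FaceIn f') : f.Mono f' ∧ f'.Mono f := by
  obtain ⟨h1, h2, h3, h4⟩ := hf.bounds (wf_up hv)
  obtain ⟨h1', h2', h3', h4'⟩ := hf'.bounds (wf_rightSide hv)
  simp only [rightSide, up, Btw, apex, apex', EdgeSlot.span] at *
  have key : f.level = f'.level → ∀ i, f.corner i ≤ f'.corner i := by
    intro hl i
    have := h4' i (by omega)
    by_cases hi' : v.level + 1 < f.level + i
    · have := h4 i hi'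
      grind
    · have h0 : i = 0 := by apply Fin.ext; simp only [Fin.val_zero]; omega
      subst h0
      have := h3 (by simp at hi'; omega)
      grind
  refine ⟨fun hl _ => key hl, fun hl hp => ?_⟩
  grind

theorem FaceIn.mono {v : VertexSlot} {f f' : Face} (h : FaceIn v f) (h' : FaceIn v f')
    (hv : v.left < v.right) : f.Mono f' := by
  induction h generalizing f' with
  | @ofLeft v f h =>
    cases h' with
    | ofLeft h' => exact h.mono h' (wf_leftSide hv)
    | ofRight h' => exact (mono_left_right hv h h').1
    | ofUp h' => exact (mono_left_up hv h h').1
  | @ofRight v f h =>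
    cases h' with
    | ofLeft h' => exact (mono_left_right hv h' h).2
    | ofRight h' => exact h.mono h' (wf_rightSide hv)
    | ofUp h' => exact (mono_up_right hv h' h).2
  | @ofUp v f h ih =>
    cases h' with
    | ofLeft h' => exact (mono_left_up hv h' h).2
    | ofRight h' => exact (mono_up_right hv h h').1
    | ofUp h' => exact ih h' (wf_up hv)

/-- The three slots at the lowest vertex `(0, 0)` of a component. -/
def root (j : Fin 3) : VertexSlot := ⟨0, 0, j, j + 1⟩

theorem root_lt (j : Fin 3) : (root j).left < (root j).right := by simp [root]

end VertexSlot

/-- The faces of a component. -/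
def CompFace (f : Face) : Prop := ∃ j, (VertexSlot.root j).FaceIn f

theorem CompFace.mono {f f' : Face} (h : CompFace f) (h' : CompFace f') : f.Mono f' := by
  obtain ⟨j, h⟩ := h
  obtain ⟨j', h'⟩ := h'
  rcases eq_or_ne j j' with rfl | hj
  · exact h.mono h' (VertexSlot.root_lt j)
  obtain ⟨h1, h2, h3, h4⟩ := h.bounds (VertexSlot.root_lt j)
  obtain ⟨h1', h2', h3', h4'⟩ := h'.bounds (VertexSlot.root_lt j')
  simp only [VertexSlot.root] at *
  intro hl hp i
  -- The root slots occupy disjoint unit intervals, so the order of the positions determines the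
  -- order of the slots.
  have hlt : (j : ℚ) + 1 ≤ (j' : ℕ) := by
    have h5 : (j : ℚ) < ((j' : ℕ) : ℚ) + 1 := by linarith
    have h6 : (j : ℕ) < (j' : ℕ) + 1 := by exact_mod_cast h5
    have h7 : (j : ℕ) ≠ j' := fun h => hj (Fin.ext h)
    have h8 : (j : ℕ) + 1 ≤ j' := by omega
    exact_mod_cast h8
  by_cases hi' : 0 < f.level + i
  · have := h4 i hi'
    have := h4' i (hl ▸ hi')
    linarith
  · have h0 : i = 0 := by apply Fin.ext; simp only [Fin.val_zero]; omega
    subst h0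
    have hl' : f.level = 0 := by simp at hi'; omega
    rw [h3 hl', h3' (hl ▸ hl')]

end ThreeTree

end SimpleGraph

namespace SimpleGraph

namespace ThreeTree

/-! ### Codes, their order, and the five queues -/

/-- The code of a vertex (or face) consists of the code of the face that surrounds its component,
followed by its own place in the component. -/
abbrev Code : Type := List (ℕ ×ₗ ℚ)

/-- The place with a given level and position. -/
def pt (s : ℕ) (x : ℚ) : ℕ ×ₗ ℚ := toLex (s, x)

theorem pt_lt_pt {s s' : ℕ} {x x' : ℚ} : pt s x < pt s' x' ↔ s < s' ∨ s = s' ∧ x < x' :=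
  Prod.Lex.toLex_lt_toLex

theorem pt_inj {s s' : ℕ} {x x' : ℚ} : pt s x = pt s' x' ↔ s = s' ∧ x = x' := by
  simp [pt]

/-- Codes are compared by length first, and then lexicographically. -/
def rank (l : Code) : ℕ ×ₗ Code := toLex (l.length, l)

theorem rank_injective : Function.Injective rank := by
  intro l l' h
  simp only [rank, toLex_inj, Prod.mk.injEq] at h
  exact h.2

theorem rank_lt_rank {l l' : Code} :
    rank l < rank l' ↔ l.length < l'.length ∨ l.length = l'.length ∧ l < l' :=
  Prod.Lex.toLex_lt_toLex

theorem append_singleton_lt {l l' : Code} {p p' : ℕ ×ₗ ℚ} (h : l.length = l'.length) :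
    l ++ [p] < l' ++ [p'] ↔ l < l' ∨ l = l' ∧ p < p' := by
  induction l generalizing l' with
  | nil =>
    obtain rfl : l' = [] := List.length_eq_zero_iff.1 h.symm
    simp [List.cons_lt_cons_iff]
  | cons a l ih =>
    cases l' with
    | nil => simp at h
    | cons a' l' =>
      simp only [List.length_cons, Nat.add_right_cancel_iff] at h
      simp only [List.cons_append, List.cons_lt_cons_iff, ih h, List.cons.injEq]
      tauto

/-- This makes layers inherit their order: vertices are compared first by the faces around their
components and only then within a component. -/
theorem rank_append_singleton_lt {l l' : Code} {p p' : ℕ ×ₗ ℚ} :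
    rank (l ++ [p]) < rank (l' ++ [p']) ↔ rank l < rank l' ∨ l = l' ∧ p < p' := by
  simp only [rank_lt_rank, List.length_append, List.length_singleton, Nat.add_lt_add_iff_right,
    Nat.add_right_cancel_iff]
  constructor
  · rintro (h | ⟨h, h'⟩)
    · exact Or.inl (Or.inl h)
    · rcases (append_singleton_lt h).1 h' with h' | h'
      · exact Or.inl (Or.inr ⟨h, h'⟩)
      · exact Or.inr h'
  · rintro ((h | ⟨h, h'⟩) | ⟨rfl, h⟩)
    · exact Or.inl h
    · exact Or.inr ⟨h, (append_singleton_lt h).2 (Or.inl h')⟩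
    · exact Or.inr ⟨rfl, (append_singleton_lt rfl).2 (Or.inr ⟨rfl, h⟩)⟩

/-- `k` is the code of a triangle, inside a component, with corners `c`. -/
def IsFace (k : Code) (c : Fin 3 → Code) : Prop :=
  ∃ g f, CompFace f ∧ k = g ++ [pt f.level f.pos] ∧
    ∀ i : Fin 3, c i = g ++ [pt (f.level + i) (f.corner i)]

/-- In different components the surrounding codes decide both comparisons. In the same component
either the levels of the triangles decide, or the levels agree and `CompFace.mono` applies. -/
theorem IsFace.mono {k k' : Code} {c c' : Fin 3 → Code} (h : IsFace k c) (h' : IsFace k' c')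
    {i : Fin 3} (hi : rank (c i) < rank (c' i)) : rank k < rank k' := by
  obtain ⟨g, f, hf, rfl, hc⟩ := h
  obtain ⟨g', f', hf', rfl, hc'⟩ := h'
  rw [hc, hc', rank_append_singleton_lt] at hi
  rw [rank_append_singleton_lt]
  refine hi.imp id fun ⟨h1, h2⟩ => ⟨h1, ?_⟩
  rw [pt_lt_pt] at h2 ⊢
  rcases h2 with h2 | ⟨h2, h3⟩
  · exact Or.inl (by omega)
  · have hl : f.level = f'.level := by omega
    refine Or.inr ⟨hl, ?_⟩
    -- Monotonicity is used contrapositively: the weak order of positions yields the weak order of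
    -- corners, so a strict order of corners yields a strict order of positions.
    by_contra hp
    exact absurd (hf'.mono hf hl.symm (not_lt.1 hp) i) (not_le.2 h3)

theorem IsFace.length_eq {k : Code} {c : Fin 3 → Code} (h : IsFace k c) (i : Fin 3) :
    (c i).length = k.length := by
  obtain ⟨g, f, -, rfl, hc⟩ := h
  simp [hc]

/-- The edges of each of the five queues, directed from the lower to the upper end: two queues for
edges inside components, and three for edges between a component and the face around it. -/
inductive InQueue : Fin 2 ⊕ Fin 3 → Code → Code → Prop
  | level {k : Code} {c : Fin 3 → Code} (h : IsFace k c) (j : Fin 2) :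
      InQueue (Sum.inl j) (c 0) (c j.succ)
  | bind {k : Code} {c : Fin 3 → Code} (h : IsFace k c) (i : Fin 3) (p : ℕ ×ₗ ℚ) :
      InQueue (Sum.inr i) (c i) (k ++ [p])

theorem InQueue.rank_lt {q : Fin 2 ⊕ Fin 3} {a b : Code} (h : InQueue q a b) :
    rank a < rank b := by
  cases h with
  | level h j =>
    obtain ⟨g, f, -, -, hc⟩ := h
    rw [hc, hc, rank_append_singleton_lt, pt_lt_pt]
    exact Or.inr ⟨rfl, Or.inl (by simp)⟩
  | bind h i p =>
    rw [rank_lt_rank, h.length_eq]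
    simp

/-- For edges inside components, the lower ends order the two triangles one way and the upper ends
the other way. For edges between layers, the order of the lower ends passes to the faces and, these
being prefixes of the upper ends, to the upper ends. -/
theorem InQueue.not_nested {q : Fin 2 ⊕ Fin 3} {a b c d : Code} (h : InQueue q a b)
    (h' : InQueue q c d) (hac : rank a < rank c) : ¬ rank d < rank b := by
  cases h with
  | level h j =>
    cases h' with
    | level h' => exact fun hlt => lt_asymm (h.mono h' hac) (h'.mono h hlt)
  | bind h i p =>
    cases h' with
    | bind h' i p' =>
      exact lt_asymm (rank_append_singleton_lt.2 (Or.inl (h.mono h' hac)))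

/-- `a` and `b` are joined by an edge of one of the five queues. -/
def CodeAdj (a b : Code) : Prop := ∃ q, InQueue q a b ∨ InQueue q b a

theorem CodeAdj.symm {a b : Code} (h : CodeAdj a b) : CodeAdj b a := by
  obtain ⟨q, h⟩ := h
  exact ⟨q, h.symm⟩

/-! ### Regions of free codes and how they split -/

/-- The codes that extend `k`. -/
def below (k : Code) : Set Code := {l | ∃ p r, l = k ++ p :: r}

/-- The codes that extend `k` by a position between `p` and `q`. -/
def inside (k : Code) (p q : ℚ) : Set Code :=
  {l | ∃ s x r, l = k ++ pt s x :: r ∧ Btw p q x}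

theorem append_mem_inside {k : Code} {p q x : ℚ} {s : ℕ} :
    k ++ [pt s x] ∈ inside k p q ↔ Btw p q x := by
  constructor
  · rintro ⟨s', x', r, h, hx⟩
    have h' := List.append_cancel_left h
    rw [List.cons.injEq, pt_inj] at h'
    rwa [h'.1.2]
  · exact fun h => ⟨s, x, [], rfl, h⟩

theorem append_notMem_below {k : Code} {p p' : ℕ ×ₗ ℚ} : k ++ [p] ∉ below (k ++ [p']) := by
  rintro ⟨p, r, h⟩
  have := congrArg List.length h
  simp at this

theorem inside_subset_below {k : Code} {p q : ℚ} : inside k p q ⊆ below k := by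
  rintro _ ⟨s, x, r, rfl, -⟩
  exact ⟨_, _, rfl⟩

theorem inside_subset_inside {k : Code} {p q p' q' : ℚ} (h : ∀ x, Btw p q x → Btw p' q' x) :
    inside k p q ⊆ inside k p' q' := by
  rintro _ ⟨s, x, r, rfl, hx⟩
  exact ⟨_, _, _, rfl, h x hx⟩

theorem below_subset_inside {k : Code} {p q x : ℚ} {s : ℕ} (h : Btw p q x) :
    below (k ++ [pt s x]) ⊆ inside k p q := by
  rintro _ ⟨p, r, rfl⟩
  exact ⟨s, x, p :: r, by simp, h⟩

theorem disjoint_inside {k : Code} {p q p' q' : ℚ} (h : ∀ x, Btw p q x → ¬ Btw p' q' x) :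
    Disjoint (inside k p q) (inside k p' q') := by
  rw [Set.disjoint_left]
  rintro _ ⟨s, x, r, rfl, hx⟩ ⟨s', x', r', he, hx'⟩
  have h' := List.append_cancel_left he
  rw [List.cons.injEq, pt_inj] at h'
  exact h x hx (h'.1.2 ▸ hx')

theorem disjoint_below_inside {k : Code} {p q x : ℚ} {s : ℕ} (h : ¬ Btw p q x) :
    Disjoint (below (k ++ [pt s x])) (inside k p q) := by
  rw [Set.disjoint_left]
  rintro _ ⟨p, r, rfl⟩ ⟨s', x', r', he, hx'⟩
  rw [List.append_assoc] at he
  have h' := List.append_cancel_left he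
  rw [List.singleton_append, List.cons.injEq, pt_inj] at h'
  exact h (h'.1.2 ▸ hx')

theorem disjoint_below_below {k : Code} {p p' : ℕ ×ₗ ℚ} (h : p ≠ p') :
    Disjoint (below (k ++ [p])) (below (k ++ [p'])) := by
  rw [Set.disjoint_left]
  rintro _ ⟨_, r, rfl⟩ ⟨_, r', he⟩
  rw [List.append_assoc, List.append_assoc] at he
  have h' := List.append_cancel_left he
  rw [List.singleton_append, List.singleton_append, List.cons.injEq] at h'
  exact h h'.1

/-- Into the triangle with corners `a`, `b`, `c` one can put vertices with codes in `S`. -/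
inductive IsRegion : Code → Code → Code → Set Code → Prop
  | face {k : Code} {c : Fin 3 → Code} (h : IsFace k c) : IsRegion (c 0) (c 1) (c 2) (below k)
  | vertex {k : Code} {c : Fin 3 → Code} (h : IsFace k c) (i j : Fin 3) (v : VertexSlot)
      (hv : v.left < v.right) (hf : ∀ f, v.FaceIn f → CompFace f) :
      IsRegion (c i) (c j) (k ++ [pt v.level v.base]) (inside k v.left v.right)
  | edge {k : Code} {c : Fin 3 → Code} (h : IsFace k c) (i : Fin 3) (e : EdgeSlot)
      (he : e.Wf) (hf : ∀ f, e.FaceIn f → CompFace f) :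
      IsRegion (c i) (k ++ [pt e.level e.lo]) (k ++ [pt (e.level + e.span) e.hi])
        (inside k e.near e.far)
  | rot {a b c : Code} {S : Set Code} (h : IsRegion a b c S) : IsRegion b c a S
  | swap {a b c : Code} {S : Set Code} (h : IsRegion a b c S) : IsRegion b a c S

/-- A vertex can be put into the triangle, such that there are three triangles for the next ones. -/
def Splits (a b c : Code) (S : Set Code) : Prop :=
  ∃ n ∈ S, ∃ S₁ S₂ S₃, (IsRegion n b c S₁ ∧ IsRegion a n c S₂ ∧ IsRegion a b n S₃) ∧
    (S₁ ⊆ S ∧ S₂ ⊆ S ∧ S₃ ⊆ S) ∧ (n ∉ S₁ ∧ n ∉ S₂ ∧ n ∉ S₃) ∧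
    (Disjoint S₁ S₂ ∧ Disjoint S₂ S₃ ∧ Disjoint S₃ S₁) ∧
    (CodeAdj n a ∧ CodeAdj n b ∧ CodeAdj n c)

theorem Splits.rot {a b c : Code} {S : Set Code} (h : Splits a b c S) : Splits b c a S := by
  obtain ⟨n, hn, S₁, S₂, S₃, ⟨h1, h2, h3⟩, ⟨s1, s2, s3⟩, ⟨n1, n2, n3⟩, ⟨d1, d2, d3⟩, a1, a2, a3⟩ := h
  exact ⟨n, hn, S₂, S₃, S₁, ⟨h2.rot, h3.rot, h1.rot⟩, ⟨s2, s3, s1⟩, ⟨n2, n3, n1⟩, ⟨d2, d3, d1⟩,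
    a2, a3, a1⟩

theorem Splits.swap {a b c : Code} {S : Set Code} (h : Splits a b c S) : Splits b a c S := by
  obtain ⟨n, hn, S₁, S₂, S₃, ⟨h1, h2, h3⟩, ⟨s1, s2, s3⟩, ⟨n1, n2, n3⟩, ⟨d1, d2, d3⟩, a1, a2, a3⟩ := h
  exact ⟨n, hn, S₂, S₁, S₃, ⟨h2.swap, h1.swap, h3.swap⟩, ⟨s2, s1, s3⟩, ⟨n2, n1, n3⟩,
    ⟨d1.symm, d3.symm, d2.symm⟩, a2, a1, a3⟩

theorem isFace_of_faceIn {e : EdgeSlot} (hf : ∀ f, e.FaceIn f → CompFace f) (k : Code) {x : ℚ}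
    (hx : x = e.apex ∨ x = e.apex') : IsFace (k ++ [pt e.level x])
      (fun i => k ++ [pt (e.level + i) ((e.face x).corner i)]) := by
  refine ⟨k, e.face x, hf _ ?_, rfl, fun i => rfl⟩
  rcases hx with rfl | rfl
  · exact .here e
  · exact .here' e

/-- An edge is put into a queue by the triangle on its free side, of which it is the edge from the
lowest corner to the middle one if short, and to the top one if long. The triangle belongs to the
universal component and need not be present in the graph. -/
theorem codeAdj_ends {e : EdgeSlot} (hf : ∀ f, e.FaceIn f → CompFace f) (k : Code) :
    CodeAdj (k ++ [pt e.level e.lo]) (k ++ [pt (e.level + e.span) e.hi]) := by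
  have h := isFace_of_faceIn hf k (Or.inl rfl)
  obtain ⟨s, lo, hi, long, p, q⟩ := e
  cases long
  · exact ⟨_, Or.inl (.level h 0)⟩
  · exact ⟨_, Or.inl (.level h 1)⟩

namespace EdgeSlot

theorem isRegion_face {e : EdgeSlot} (hf : ∀ f, e.FaceIn f → CompFace f) (k : Code) {x : ℚ}
    (hx : x = e.apex ∨ x = e.apex') :
    IsRegion (k ++ [pt (e.level + e.lower.span) e.apex]) (k ++ [pt e.level e.lo])
      (k ++ [pt (e.level + e.span) e.hi]) (below (k ++ [pt e.level x])) := by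
  have h := IsRegion.face (isFace_of_faceIn hf k hx)
  obtain ⟨s, lo, hi, long, p, q⟩ := e
  cases long
  · exact h.rot.rot
  · exact h.swap

theorem isRegion_upper {e : EdgeSlot} (he : e.Wf) (hf : ∀ f, e.FaceIn f → CompFace f) {k : Code}
    {c : Fin 3 → Code} (h : IsFace k c) (i : Fin 3) :
    IsRegion (c i) (k ++ [pt (e.level + e.lower.span) e.apex])
      (k ++ [pt (e.level + e.span) e.hi]) (inside k e.upper.near e.upper.far) := by
  have h := IsRegion.edge h i e.upper he.upper fun f h => hf f (.ofUpper h)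
  obtain ⟨s, lo, hi, long, p, q⟩ := e
  cases long
  · exact h.swap.rot
  · exact h

/-- The edge between the middle and the top corner has no queue by virtue of its own triangle; it is
the short edge from the lowest corner of the next triangle, in the upper slot. -/
theorem codeAdj_apex_upper {e : EdgeSlot} (hf : ∀ f, e.FaceIn f → CompFace f) (k : Code) :
    CodeAdj (k ++ [pt (e.level + e.lower.span) e.apex]) (k ++ [pt (e.level + e.span) e.hi]) := by
  have h := codeAdj_ends (e := e.upper) (fun f h => hf f (.ofUpper h)) k
  obtain ⟨s, lo, hi, long, p, q⟩ := e
  cases long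
  · exact h.symm
  · exact h

theorem btw_lower {e : EdgeSlot} {x : ℚ} (hx : Btw e.lower.near e.lower.far x) :
    Btw e.near e.far x ∧ Btw e.apex e.far x := by
  simp only [Btw, lower, apex, apex'] at *
  grind

theorem btw_upper {e : EdgeSlot} (he : e.Wf) {x : ℚ} (hx : Btw e.upper.near e.upper.far x) :
    Btw e.near e.far x ∧ Btw e.near e.apex x := by
  obtain ⟨s, lo, hi, long, p, q⟩ := e
  cases long <;> simp [Wf, Btw, upper, apex] at * <;> grind

theorem btw_apex {e : EdgeSlot} (he : e.Wf) : Btw e.near e.far e.apex := by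
  simp only [Wf, Btw, apex] at *
  grind

end EdgeSlot

theorem not_btw_left {p q : ℚ} : ¬ Btw p q p := by simp [Btw]

theorem not_btw_right {p q : ℚ} : ¬ Btw p q q := by simp [Btw]

theorem not_btw_of_btw {p m q x : ℚ} (hm : Btw p q m) (h : Btw m q x) : ¬ Btw p m x := by
  simp only [Btw] at *
  grind

/-- The new vertex starts a component at `(0, 0)`. Each of the three new triangles has two corners
of the old face, and gets one of the root slots. -/
theorem splits_face {k : Code} {c : Fin 3 → Code} (h : IsFace k c) :
    Splits (c 0) (c 1) (c 2) (below k) := by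
  have hr : ∀ (j i i' : Fin 3), IsRegion (c i) (c i') (k ++ [pt 0 0]) (inside k j (j + 1)) :=
    fun j i i' => IsRegion.vertex h i i' (.root j) (VertexSlot.root_lt j) fun f hf => ⟨j, hf⟩
  have hn : ∀ j : Fin 3, k ++ [pt 0 0] ∉ inside k j (j + 1) := by
    intro j
    rw [append_mem_inside]
    rintro (h | h)
    · exact absurd h.1 (not_lt.2 (Nat.cast_nonneg _))
    · linarith
  have hd : ∀ j j' : Fin 3, j < j' → Disjoint (inside k j (j + 1)) (inside k j' (j' + 1)) := by
    intro j j' hj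
    have : (j : ℚ) + 1 ≤ j' := by exact_mod_cast hj
    refine disjoint_inside fun x hx hx' => ?_
    simp only [Btw] at hx hx'
    grind
  have ha : ∀ i, CodeAdj (k ++ [pt 0 0]) (c i) := fun i => ⟨_, Or.inr (.bind h i _)⟩
  exact ⟨k ++ [pt 0 0], ⟨_, _, rfl⟩, _, _, _,
    ⟨(hr 0 1 2).rot.rot, (hr 1 0 2).swap.rot, hr 2 0 1⟩,
    ⟨inside_subset_below, inside_subset_below, inside_subset_below⟩, ⟨hn 0, hn 1, hn 2⟩,
    ⟨hd 0 1 (by decide), hd 1 2 (by decide), (hd 0 2 (by decide)).symm⟩, ha 0, ha 1, ha 2⟩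

/-- The new vertex continues the component by an edge. The two sides of this edge become edge slots,
each facing one outer corner, and the triangle with both outer corners becomes the slot above the
apex. -/
theorem splits_vertex {k : Code} {c : Fin 3 → Code} (h : IsFace k c) (i j : Fin 3) (v : VertexSlot)
    (hv : v.left < v.right) (hf : ∀ f, v.FaceIn f → CompFace f) :
    Splits (c i) (c j) (k ++ [pt v.level v.base]) (inside k v.left v.right) := by
  have hL := IsRegion.edge h i v.leftSide (VertexSlot.wf_leftSide hv) fun f h => hf f (.ofLeft h)
  have hR := IsRegion.edge h j v.rightSide (VertexSlot.wf_rightSide hv) fun f h => hf f (.ofRight h)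
  have hU := IsRegion.vertex h i j v.up (VertexSlot.wf_up hv) fun f h => hf f (.ofUp h)
  have hE := codeAdj_ends (e := v.leftSide) (fun f h => hf f (.ofLeft h)) k
  have hb : Btw v.left v.right v.apex := by
    left; simp only [VertexSlot.apex]; constructor <;> linarith
  refine ⟨k ++ [pt (v.level + 1) v.apex], append_mem_inside.2 hb, _, _, _,
    ⟨hR.rot.rot, hL.swap.rot, hU⟩, ⟨?_, ?_, ?_⟩, ⟨?_, ?_, ?_⟩, ⟨?_, ?_, ?_⟩,
    ⟨_, Or.inr (.bind h i _)⟩, ⟨_, Or.inr (.bind h j _)⟩, hE.symm⟩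
  case refine_4 | refine_5 | refine_6 =>
    rw [append_mem_inside]
    simp only [Btw, VertexSlot.leftSide, VertexSlot.rightSide, VertexSlot.up, VertexSlot.apex,
      VertexSlot.apex']
    grind
  case refine_1 | refine_2 | refine_3 =>
    apply inside_subset_inside
    intro x
    simp only [Btw, VertexSlot.leftSide, VertexSlot.rightSide, VertexSlot.up, VertexSlot.apex,
      VertexSlot.apex']
    grind
  all_goals
    apply disjoint_inside
    intro x
    simp only [Btw, VertexSlot.leftSide, VertexSlot.rightSide, VertexSlot.up, VertexSlot.apex,
      VertexSlot.apex']
    grind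

/-- The new vertex closes a triangle inside the component, whose interior holds the next layer; the
other two new triangles face the outer corner across the lower and the upper edge. -/
theorem splits_edge {k : Code} {c : Fin 3 → Code} (h : IsFace k c) (i : Fin 3) (e : EdgeSlot)
    (he : e.Wf) (hf : ∀ f, e.FaceIn f → CompFace f) :
    Splits (c i) (k ++ [pt e.level e.lo]) (k ++ [pt (e.level + e.span) e.hi])
        (inside k e.near e.far) := by
  have hF := EdgeSlot.isRegion_face hf k (Or.inl rfl)
  have hL := IsRegion.edge h i e.lower he.lower fun f h => hf f (.ofLower h)
  have hU := EdgeSlot.isRegion_upper he hf h i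
  have hE := codeAdj_ends (e := e.lower) (fun f h => hf f (.ofLower h)) k
  have hE' := EdgeSlot.codeAdj_apex_upper hf k
  have hb := EdgeSlot.btw_apex he
  have hnU : ¬ Btw e.upper.near e.upper.far e.apex :=
    fun h => not_btw_right (EdgeSlot.btw_upper he h).2
  have hnL : ¬ Btw e.lower.near e.lower.far e.apex :=
    fun h => not_btw_left (EdgeSlot.btw_lower h).2
  exact ⟨k ++ [pt (e.level + e.lower.span) e.apex], append_mem_inside.2 hb, _, _, _,
    ⟨hF, hU, hL⟩,
    ⟨below_subset_inside hb, inside_subset_inside fun x hx => (EdgeSlot.btw_upper he hx).1,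
      inside_subset_inside fun x hx => (EdgeSlot.btw_lower hx).1⟩,
    ⟨append_notMem_below, fun h => hnU (append_mem_inside.1 h),
      fun h => hnL (append_mem_inside.1 h)⟩,
    ⟨disjoint_below_inside hnU, disjoint_inside fun x hx hx' =>
      not_btw_of_btw hb (EdgeSlot.btw_lower hx').2 (EdgeSlot.btw_upper he hx).2,
      (disjoint_below_inside hnL).symm⟩,
    ⟨_, Or.inr (.bind h i _)⟩, hE.symm, hE'⟩

theorem IsRegion.splits {a b c : Code} {S : Set Code} (h : IsRegion a b c S) : Splits a b c S := by
  induction h with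
  | face h => exact splits_face h
  | vertex h i j v hv hf => exact splits_vertex h i j v hv hf
  | edge h i e he hf => exact splits_edge h i e he hf
  | rot _ ih => exact ih.rot
  | swap _ ih => exact ih.swap

/-- There is a triangle both sides of which can be filled with vertices. -/
theorem exists_initial_triangle : ∃ (a : Fin 3 → Code) (S S' : Set Code), Function.Injective a ∧
    IsRegion (a 0) (a 1) (a 2) S ∧ IsRegion (a 0) (a 1) (a 2) S' ∧ Disjoint S S' ∧
    (∀ i, a i ∉ S) ∧ (∀ i, a i ∉ S') ∧ ∀ i j, i ≠ j → CodeAdj (a i) (a j) := by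
  have hv := VertexSlot.root_lt 0
  set e := (VertexSlot.root 0).leftSide with he
  have hf : ∀ f, e.FaceIn f → CompFace f := fun f h => ⟨0, .ofLeft h⟩
  have h := isFace_of_faceIn hf [] (Or.inl rfl)
  -- The corners of the triangle on an edge do not depend on which of its two positions is taken.
  -- Hence the same triangle is a face twice, once for its inside and once for its outside; the
  -- second position exists for this purpose.
  have h' := isFace_of_faceIn hf [] (Or.inr rfl)
  have h01 := codeAdj_ends hf []
  have h02 := codeAdj_ends (e := e.lower) (fun f h => hf f (.ofLower h)) []
  have h12 := EdgeSlot.codeAdj_apex_upper hf []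
  refine ⟨_, _, _, ?_, .face h, .face h', ?_, fun i => append_notMem_below,
    fun i => append_notMem_below, ?_⟩
  · intro i j hij
    have := List.append_cancel_left hij
    rw [List.cons.injEq, pt_inj] at this
    exact Fin.ext (by omega)
  · apply disjoint_below_below
    rw [Ne, pt_inj]
    rintro ⟨-, h⟩
    simp only [EdgeSlot.apex, EdgeSlot.apex', he, VertexSlot.leftSide, VertexSlot.apex,
      VertexSlot.root] at h
    norm_num at h
  · intro i j hij
    fin_cases i <;> fin_cases j <;> first
      | exact absurd rfl hij
      | exact h01
      | exact h02
      | exact h12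
      | exact h01.symm
      | exact h02.symm
      | exact h12.symm

end ThreeTree

end SimpleGraph

namespace SimpleGraph

/-! ### Triangulated rotation systems, Euler's formula, and degree three -/

theorem _root_.Equiv.Perm.SameCycle.exists_pow_lt {α : Type*} {f : Equiv.Perm α} {x y : α}
    (h : f.SameCycle x y) {n : ℕ} (hn : 0 < n) (hx : (f ^ n) x = x) :
    ∃ r < n, (f ^ r) x = y := by
  obtain ⟨i, rfl⟩ := h
  have hn' : (n : ℤ) ≠ 0 := by omega
  obtain ⟨r, hr⟩ := Int.eq_ofNat_of_zero_le (Int.emod_nonneg i hn')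
  refine ⟨r, ?_, ?_⟩
  · have := Int.emod_lt_of_pos i (by omega : (0 : ℤ) < n)
    omega
  · have h1 : i = r + n * (i / n) := by rw [← hr]; exact (Int.emod_add_mul_ediv i n).symm
    rw [h1, zpow_add, zpow_mul, Equiv.Perm.mul_apply, zpow_natCast, zpow_natCast,
      Equiv.Perm.zpow_apply_eq_self_of_apply_eq_self hx]

theorem Dart.ext' {V : Type u} {G : SimpleGraph V} {d e : G.Dart} (h : d.fst = e.fst)
    (h' : d.snd = e.snd) : d = e :=
  Dart.ext _ _ (Prod.ext h h')

namespace RotationSystem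

variable {V : Type u} {G : SimpleGraph V} (R : RotationSystem G)

theorem fst_next (d : G.Dart) : (R.next d).fst = d.fst :=
  ((R.sameCycle_iff d (R.next d)).1 ⟨1, by simp⟩).symm

theorem fst_faceNext (d : G.Dart) : (R.faceNext d).fst = d.snd := R.fst_next d.symm

variable {R}

theorem isTriangulated_of_faceNext
    (h : ∀ d, R.faceNext (R.faceNext (R.faceNext d)) = d) : R.IsTriangulated := by
  intro d
  have := Fact.mk Nat.prime_three
  refine Function.minimalPeriod_eq_prime (h d) fun hd => ?_
  have h1 := R.fst_faceNext d
  rw [hd] at h1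
  exact d.fst_ne_snd h1

namespace IsTriangulated

variable (hR : R.IsTriangulated)
include hR

theorem faceNext_faceNext_faceNext (d : G.Dart) :
    R.faceNext (R.faceNext (R.faceNext d)) = d := by
  have h := Function.isPeriodicPt_minimalPeriod R.faceNext d
  rw [hR d] at h
  exact h

theorem snd_faceNext_faceNext (d : G.Dart) : (R.faceNext (R.faceNext d)).snd = d.fst := by
  rw [← R.fst_faceNext, hR.faceNext_faceNext_faceNext]

theorem sameCycle {d e : G.Dart} : R.faceNext.SameCycle d e ↔
    e = d ∨ e = R.faceNext d ∨ e = R.faceNext (R.faceNext d) := by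
  constructor
  · intro h
    obtain ⟨r, hr, rfl⟩ := h.exists_pow_lt (n := 3) (by norm_num)
      (hR.faceNext_faceNext_faceNext d)
    interval_cases r
    · exact Or.inl rfl
    · exact Or.inr (Or.inl rfl)
    · exact Or.inr (Or.inr rfl)
  · rintro (rfl | rfl | rfl)
    · exact .refl _ _
    · exact ⟨1, rfl⟩
    · exact ⟨2, rfl⟩

theorem card_dart [Finite V] : Nat.card G.Dart = 3 * Nat.card R.Face := by
  classical
  have := Fintype.ofFinite V
  have : Finite R.Face := Quotient.finite _
  have := Fintype.ofFinite R.Face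
  let π : G.Dart → R.Face := Quotient.mk _
  have hc : ∀ f : R.Face, Nat.card {d // π d = f} = 3 := by
    intro f
    obtain ⟨d, rfl⟩ := Quotient.exists_rep f
    have hs : {e | π e = π d} = {d, R.faceNext d, R.faceNext (R.faceNext d)} := by
      ext e
      have : π e = π d ↔ R.faceNext.SameCycle d e :=
        Quotient.eq.trans Equiv.Perm.sameCycle_comm
      rw [Set.mem_ofPred_eq, this, hR.sameCycle]
      rfl
    have h1 : d ≠ R.faceNext d := fun h => d.fst_ne_snd (by rw [← R.fst_faceNext, ← h])
    have h2 : R.faceNext d ≠ R.faceNext (R.faceNext d) := fun h => h1 (R.faceNext.injective h)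
    have h3 : d ≠ R.faceNext (R.faceNext d) := fun h => by
      have := hR.faceNext_faceNext_faceNext d
      rw [← h] at this
      exact h1 this.symm
    change Nat.card ({e | π e = π d} : Set G.Dart) = 3
    rw [hs, Nat.card_coe_set_eq, Set.ncard_eq_three]
    exact ⟨_, _, _, h1, h3, h2, rfl⟩
  rw [← Nat.card_congr (Equiv.sigmaFiberEquiv π), Nat.card_sigma, Finset.sum_congr rfl
    fun f _ => hc f, Finset.sum_const, Finset.card_univ, Nat.card_eq_fintype_card, smul_eq_mul,
    mul_comm]

end IsTriangulated

end RotationSystem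

/-- The darts give `2|E| = 3|F|`, and Euler's formula eliminates `|F|`. -/
theorem IsPlaneTriangulation.card_edgeSet {V : Type u} {G : SimpleGraph V}
    (h : G.IsPlaneTriangulation) : Nat.card G.edgeSet + 6 = 3 * Nat.card V := by
  classical
  obtain ⟨h3, R, hP, hT⟩ := h
  have : Finite V := Nat.finite_of_card_ne_zero (by omega)
  have := Fintype.ofFinite V
  have h1 := hT.card_dart
  rw [Nat.card_eq_fintype_card, G.dart_card_eq_twice_card_edges] at h1
  have h2 : Nat.card G.edgeSet = G.edgeFinset.card := by
    rw [Nat.card_eq_fintype_card, edgeFinset_card]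
  have := hP.2
  omega

theorem IsPlanarThreeTree.card_edgeSet {V : Type u} {G : SimpleGraph V}
    (h : G.IsPlanarThreeTree) : Nat.card G.edgeSet + 6 = 3 * Nat.card V := by
  classical
  cases h with
  | triangle _ h3 ht =>
    have : Finite V := Nat.finite_of_card_ne_zero (by omega)
    have := Fintype.ofFinite V
    subst ht
    have h2 : Nat.card (⊤ : SimpleGraph V).edgeSet = (⊤ : SimpleGraph V).edgeFinset.card := by
      rw [Nat.card_eq_fintype_card, edgeFinset_card]
    rw [h2, card_edgeFinset_top_eq_card_choose_two, ← Nat.card_eq_fintype_card, h3]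
    decide
  | step _ _ ht => exact ht.card_edgeSet

theorem IsPlanarThreeTree.three_le_card {V : Type u} {G : SimpleGraph V}
    (h : G.IsPlanarThreeTree) : 3 ≤ Nat.card V := by
  cases h <;> omega

theorem IsPlanarThreeTree.finite {V : Type u} {G : SimpleGraph V}
    (h : G.IsPlanarThreeTree) : Finite V :=
  Nat.finite_of_card_ne_zero (by have := h.three_le_card; omega)

/-- Both graphs have three times as many edges as vertices, minus six; the difference is the degree
of the deleted vertex. -/
theorem IsPlanarThreeTree.ncard_neighborSet {V : Type u} {G : SimpleGraph V} {v : V}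
    (h : G.IsPlanarThreeTree) (h' : (G.induce ({v}ᶜ : Set V)).IsPlanarThreeTree) :
    (G.neighborSet v).ncard = 3 := by
  classical
  have := h.finite
  have := Fintype.ofFinite V
  have h1 := h.card_edgeSet
  have h2 := h'.card_edgeSet
  have h3 : Nat.card ({v}ᶜ : Set V) = Nat.card V - 1 := by
    rw [Nat.card_coe_set_eq, Set.ncard_compl, Set.ncard_singleton]
  have h4 := G.card_edgeFinset_induce_compl_singleton v
  rw [card_edgeFinset_deleteIncidenceSet] at h4
  have h5 : Nat.card G.edgeSet = G.edgeFinset.card := by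
    rw [Nat.card_eq_fintype_card, edgeFinset_card]
  have h6 : Nat.card (G.induce ({v}ᶜ : Set V)).edgeSet =
      (G.induce ({v}ᶜ : Set V)).edgeFinset.card := by
    rw [Nat.card_eq_fintype_card, edgeFinset_card]
  have h7 : (G.neighborSet v).ncard = G.degree v := by
    rw [Set.ncard_eq_toFinset_card', ← neighborFinset, card_neighborFinset_eq_degree]
  have h8 := h'.three_le_card
  omega

/-! ### Deleting a vertex from a rotation system -/

namespace RotationSystem

variable {V : Type u} {G : SimpleGraph V} {R : RotationSystem G}

/-- The neighbours of a vertex of degree three in the order of the rotation. -/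
theorem exists_neighbors (R : RotationSystem G) {v : V} (h : (G.neighborSet v).ncard = 3) :
    ∃ (a b c : V) (ha : G.Adj v a) (hb : G.Adj v b) (hc : G.Adj v c),
      a ≠ b ∧ b ≠ c ∧ c ≠ a ∧ (∀ x, G.Adj v x → x = a ∨ x = b ∨ x = c) ∧
      R.next ⟨(v, a), ha⟩ = ⟨(v, b), hb⟩ ∧ R.next ⟨(v, b), hb⟩ = ⟨(v, c), hc⟩ ∧
      R.next ⟨(v, c), hc⟩ = ⟨(v, a), ha⟩ := by
  obtain ⟨x, y, z, hxy, hxz, hyz, hs⟩ := Set.ncard_eq_three.1 h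
  have hall : ∀ w, G.Adj v w ↔ w = x ∨ w = y ∨ w = z := by
    intro w
    rw [← mem_neighborSet, hs]
    rfl
  have hx : G.Adj v x := (hall x).2 (by simp)
  have hn : ∀ w (hw : G.Adj v w), ∃ u, ∃ hu : G.Adj v u, R.next ⟨(v, w), hw⟩ = ⟨(v, u), hu⟩ := by
    intro w hw
    have h1 := R.fst_next ⟨(v, w), hw⟩
    refine ⟨(R.next ⟨(v, w), hw⟩).snd, ?_, Dart.ext' h1 rfl⟩
    have := (R.next ⟨(v, w), hw⟩).adj
    rwa [h1] at this
  have hex : ∀ w, ∃ u, G.Adj v u ∧ u ≠ x ∧ u ≠ w := by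
    intro w
    by_cases hw : y = w
    · exact ⟨z, (hall z).2 (by simp), hxz.symm, fun h => hyz (hw.trans h.symm)⟩
    · exact ⟨y, (hall y).2 (by simp), hxy.symm, hw⟩
  obtain ⟨b, hb, hab⟩ := hn x hx
  obtain ⟨c, hc, hbc⟩ := hn b hb
  obtain ⟨a, ha, hca⟩ := hn c hc
  have hxb : x ≠ b := by
    rintro rfl
    obtain ⟨u, hu, hux, -⟩ := hex x
    have := ((R.sameCycle_iff ⟨(v, x), hx⟩ ⟨(v, u), hu⟩).2 rfl).eq_of_left hab
    exact hux (congrArg (fun d : G.Dart => d.snd) this).symm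
  have hcb : b ≠ c := by
    rintro rfl
    have := R.next.injective (hab.trans hbc.symm)
    exact hxb (congrArg (fun d : G.Dart => d.snd) this)
  have hcx : c ≠ x := by
    rintro rfl
    obtain ⟨u, hu, hux, hub⟩ := hex b
    obtain ⟨r, hr, he⟩ := ((R.sameCycle_iff ⟨(v, c), hx⟩ ⟨(v, u), hu⟩).2 rfl).exists_pow_lt
      (n := 2) (by norm_num) (by rw [pow_two, Equiv.Perm.mul_apply, hab, hbc])
    interval_cases r
    · exact hux (congrArg (fun d : G.Dart => d.snd) he).symm
    · rw [pow_one, hab] at he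
      exact hub (congrArg (fun d : G.Dart => d.snd) he).symm
  have hall' : ∀ w, G.Adj v w → w = x ∨ w = b ∨ w = c := by
    intro w hw
    have h1 := (hall w).1 hw
    have h2 := (hall b).1 hb
    have h3 := (hall c).1 hc
    grind
  have hax : a = x := by
    rcases hall' a ha with h | rfl | rfl
    · exact h
    · have := R.next.injective (hab.trans hca.symm)
      exact absurd (congrArg (fun d : G.Dart => d.snd) this).symm hcx
    · have := R.next.injective (hbc.trans hca.symm)
      exact absurd (congrArg (fun d : G.Dart => d.snd) this) hcb
  subst hax
  exact ⟨a, b, c, hx, hb, hc, hxb, hcb, hcx, hall', hab, hbc, hca⟩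

/-- Two consecutive edges at a vertex span a face. -/
theorem IsTriangulated.faceNext_of_next (hR : R.IsTriangulated) {v a b : V} (ha : G.Adj v a)
    (hb : G.Adj v b) (h : R.next ⟨(v, a), ha⟩ = ⟨(v, b), hb⟩) : ∃ hba : G.Adj b a,
      R.faceNext ⟨(a, v), ha.symm⟩ = ⟨(v, b), hb⟩ ∧
      R.faceNext ⟨(v, b), hb⟩ = ⟨(b, a), hba⟩ ∧
      R.faceNext ⟨(b, a), hba⟩ = ⟨(a, v), ha.symm⟩ := by
  have h1 : R.faceNext ⟨(a, v), ha.symm⟩ = ⟨(v, b), hb⟩ := h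
  have h2 := hR.snd_faceNext_faceNext ⟨(a, v), ha.symm⟩
  have h3 := R.fst_faceNext ⟨(v, b), hb⟩
  rw [h1] at h2
  have hba : G.Adj b a := by
    have := (R.faceNext ⟨(v, b), hb⟩).adj
    rw [h2, h3] at this
    exact this
  have h4 : R.faceNext ⟨(v, b), hb⟩ = ⟨(b, a), hba⟩ := Dart.ext' h3 h2
  refine ⟨hba, h1, h4, ?_⟩
  rw [← h4, ← h1, hR.faceNext_faceNext_faceNext]

/-- The dart of `G` given by a dart of the graph without `v`. -/
def ofDelete {v : V} (d : (G.induce ({v}ᶜ : Set V)).Dart) : G.Dart := ⟨(d.fst, d.snd), d.adj⟩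

theorem ofDelete_injective {v : V} :
    Function.Injective (ofDelete : (G.induce ({v}ᶜ : Set V)).Dart → G.Dart) := by
  intro d e h
  exact Dart.ext' (Subtype.ext (congrArg (fun d : G.Dart => d.fst) h))
    (Subtype.ext (congrArg (fun d : G.Dart => d.snd) h))

theorem fst_ofDelete_ne {v : V} (d : (G.induce ({v}ᶜ : Set V)).Dart) : (ofDelete d).fst ≠ v :=
  d.fst.2

theorem snd_ofDelete_ne {v : V} (d : (G.induce ({v}ᶜ : Set V)).Dart) : (ofDelete d).snd ≠ v :=
  d.snd.2

theorem exists_ofDelete_eq {v : V} {d : G.Dart} (h : d.fst ≠ v) (h' : d.snd ≠ v) :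
    ∃ e : (G.induce ({v}ᶜ : Set V)).Dart, ofDelete e = d :=
  ⟨⟨(⟨d.fst, h⟩, ⟨d.snd, h'⟩), d.adj⟩, rfl⟩

/-- A vertex can be deleted from a rotation system. -/
theorem IsTriangulated.exists_delete [Finite V] (hR : R.IsTriangulated) (v : V) :
    ∃ R' : RotationSystem (G.induce ({v}ᶜ : Set V)),
      (∀ d, (R.faceNext (ofDelete d)).snd ≠ v →
        ofDelete (R'.faceNext d) = R.faceNext (ofDelete d)) ∧
      (∀ d, (R.faceNext (ofDelete d)).snd = v →
        ofDelete (R'.faceNext d) = R.faceNext (R.faceNext (ofDelete d)).symm) := by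
  classical
  -- If two consecutive darts both ended in `v`, they would be equal, and the triangular face there
  -- would contain a loop. So `v` never has to be skipped twice in succession.
  have hv : ∀ e : G.Dart, e.snd = v → (R.next e).snd ≠ v := by
    intro e he he'
    have h1 : R.faceNext e.symm = e := Dart.ext' (R.fst_next e) (he'.trans he.symm)
    have h2 := hR.snd_faceNext_faceNext e.symm
    rw [h1] at h2
    exact (R.faceNext e).fst_ne_snd ((R.fst_faceNext e).trans h2.symm)
  have hex : ∀ d : (G.induce ({v}ᶜ : Set V)).Dart, ∃ e : (G.induce ({v}ᶜ : Set V)).Dart,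
      ofDelete e = if (R.next (ofDelete d)).snd = v then R.next (R.next (ofDelete d))
        else R.next (ofDelete d) := by
    intro d
    split_ifs with h
    · exact exists_ofDelete_eq (by rw [R.fst_next, R.fst_next]; exact fst_ofDelete_ne d) (hv _ h)
    · exact exists_ofDelete_eq (by rw [R.fst_next]; exact fst_ofDelete_ne d) h
  choose f hf using hex
  have hinj : Function.Injective f := by
    intro d e hde
    have h1 := hf d
    rw [hde, hf e] at h1
    apply ofDelete_injective
    split_ifs at h1 with h2 h3 h3
    · exact (R.next.injective (R.next.injective h1)).symm
    · have := R.next.injective h1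
      exact absurd (this ▸ h2) (snd_ofDelete_ne d)
    · have := R.next.injective h1
      exact absurd (this.symm ▸ h3) (snd_ofDelete_ne e)
    · exact (R.next.injective h1).symm
  have : Finite (G.induce ({v}ᶜ : Set V)).Dart := Finite.of_injective _ Dart.toProd_injective
  have : Finite G.Dart := Finite.of_injective _ Dart.toProd_injective
  let next : Equiv.Perm (G.induce ({v}ᶜ : Set V)).Dart :=
    Equiv.ofBijective f (Finite.injective_iff_bijective.1 hinj)
  have hfst : ∀ d, (f d).fst = d.fst := by
    intro d
    apply Subtype.ext
    change (ofDelete (f d)).fst = (ofDelete d).fst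
    rw [hf]
    split_ifs <;> simp only [R.fst_next]
  -- The new rotation follows the old one, with a dart into `v` costing two old steps at once; hence
  -- the strong induction on the number of old steps.
  have hpow : ∀ (n : ℕ) (d e : (G.induce ({v}ᶜ : Set V)).Dart),
      (R.next ^ n) (ofDelete d) = ofDelete e → next.SameCycle d e := by
    intro n
    induction n using Nat.strong_induction_on with
    | _ n ih =>
      intro d e h
      have key : next.SameCycle (f d) e → next.SameCycle d e := fun h =>
        (show next.SameCycle d (f d) from ⟨1, rfl⟩).trans h
      rcases n with _ | n
      · rw [ofDelete_injective h]
      · rw [pow_succ, Equiv.Perm.mul_apply] at h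
        by_cases hd : (R.next (ofDelete d)).snd = v
        · rcases n with _ | n
          · simp only [pow_zero, Equiv.Perm.one_apply] at h
            exact absurd (h ▸ hd) (snd_ofDelete_ne e)
          · rw [pow_succ, Equiv.Perm.mul_apply] at h
            exact key (ih n (by omega) _ _ (by rw [hf, if_pos hd, h]))
        · exact key (ih n (by omega) _ _ (by rw [hf, if_neg hd, h]))
  refine ⟨⟨next, fun d e => ⟨?_, fun h => ?_⟩⟩, fun d h => ?_, fun d h => ?_⟩
  · rintro ⟨i, rfl⟩
    have h1 : ∀ (n : ℕ) d, ((next ^ n) d).fst = d.fst := by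
      intro n
      induction n with
      | zero => intro d; rfl
      | succ n ih => intro d; rw [pow_succ, Equiv.Perm.mul_apply, ih]; exact hfst d
    rcases i with n | n
    · exact (h1 n d).symm
    · rw [zpow_negSucc]
      have := h1 (n + 1) ((next ^ (n + 1))⁻¹ d)
      rwa [← Equiv.Perm.mul_apply, mul_inv_cancel, Equiv.Perm.one_apply] at this
  · have h1 : (ofDelete d).fst = (ofDelete e).fst := congrArg Subtype.val h
    obtain ⟨n, -, hn⟩ := ((R.sameCycle_iff _ _).2 h1).exists_pow_eq'
    exact hpow n d e hn
  · exact (hf d.symm).trans (if_neg h)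
  · exact (hf d.symm).trans (if_pos h)

end RotationSystem

end SimpleGraph

namespace SimpleGraph

open RotationSystem

namespace ThreeTree

/-! ### Codes for the vertices of a planar 3-tree -/

/-- Codes for the vertices of `G`, with disjoint regions of codes for the faces. -/
structure Stacking {V : Type u} {G : SimpleGraph V} (R : RotationSystem G) where
  code : V → Code
  region : G.Dart → Set Code
  code_injective : Function.Injective code
  region_faceNext : ∀ d, region (R.faceNext d) = region d
  disjoint : ∀ d e, ¬ R.faceNext.SameCycle d e → Disjoint (region d) (region e)
  notMem_region : ∀ u d, code u ∉ region d
  isRegion : ∀ d, IsRegion (code d.fst) (code d.snd) (code (R.faceNext d).snd) (region d)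
  codeAdj : ∀ u w, G.Adj u w → CodeAdj (code u) (code w)

theorem IsRegion.of_ne {a : Fin 3 → Code} {S : Set Code} (h : IsRegion (a 0) (a 1) (a 2) S)
    {i j k : Fin 3} (hij : i ≠ j) (hik : i ≠ k) (hjk : j ≠ k) : IsRegion (a i) (a j) (a k) S := by
  fin_cases i <;> fin_cases j <;> fin_cases k <;> first
    | exact absurd rfl hij
    | exact absurd rfl hik
    | exact absurd rfl hjk
    | exact h
    | exact h.rot
    | exact h.rot.rot
    | exact h.swap
    | exact h.swap.rot
    | exact h.swap.rot.rot

theorem nonempty_stacking_triangle {V : Type u} {G : SimpleGraph V} (h3 : Nat.card V = 3)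
    {R : RotationSystem G} (hR : R.IsTriangulated) : Nonempty (Stacking R) := by
  classical
  have : Finite V := Nat.finite_of_card_ne_zero (by omega)
  let φ : V ≃ Fin 3 := Finite.equivFinOfCardEq h3
  obtain ⟨a, S, S', ha, hS, hS', hd, hn, hn', hadj⟩ := exists_initial_triangle
  have hne : ∀ d : G.Dart, φ d.fst ≠ φ d.snd ∧ φ d.fst ≠ φ (R.faceNext d).snd ∧
      φ d.snd ≠ φ (R.faceNext d).snd := by
    intro d
    refine ⟨φ.injective.ne d.fst_ne_snd, φ.injective.ne ?_, φ.injective.ne ?_⟩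
    · have h1 := (R.faceNext (R.faceNext d)).fst_ne_snd
      rw [R.fst_faceNext, hR.snd_faceNext_faceNext] at h1
      exact h1.symm
    · have h1 := (R.faceNext d).fst_ne_snd
      rwa [R.fst_faceNext] at h1
  -- The orientation of a dart along the cycle on `Fin 3` is constant on faces and tells the two
  -- faces apart.
  let P : G.Dart → Prop := fun d => φ d.snd = φ d.fst + 1
  have hP : ∀ d, P (R.faceNext d) ↔ P d := by
    intro d
    obtain ⟨h1, h2, h3⟩ := hne d
    simp only [P, R.fst_faceNext]
    have fin3 : ∀ x y z : Fin 3, x ≠ y → x ≠ z → y ≠ z → (z = y + 1 ↔ y = x + 1) := by decide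
    exact fin3 _ _ _ h1 h2 h3
  have hcyc : ∀ d e, (P d ↔ P e) → R.faceNext.SameCycle d e := by
    intro d e hde
    have key : ∀ d : G.Dart, (P d ↔ P e) → φ e.fst = φ d.fst → e = d := by
      intro d hde hf
      refine Dart.ext' (φ.injective hf) (φ.injective ?_)
      have h1 := (hne d).1
      have h2 := (hne e).1
      simp only [P] at hde
      rw [hf] at hde h2
      have fin3 : ∀ x y z : Fin 3, x ≠ y → x ≠ z → (y = x + 1 ↔ z = x + 1) → z = y := by decide
      exact fin3 _ _ _ h1 h2 hde
    rw [hR.sameCycle]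
    have h1 : φ e.fst = φ d.fst ∨ φ e.fst = φ d.snd ∨ φ e.fst = φ (R.faceNext d).snd := by
      obtain ⟨h1, h2, h3⟩ := hne d
      have fin3 : ∀ x y z w : Fin 3, x ≠ y → x ≠ z → y ≠ z → w = x ∨ w = y ∨ w = z := by decide
      exact fin3 _ _ _ _ h1 h2 h3
    refine h1.imp (key d hde) (Or.imp (fun h => key _ ((hP d).trans hde) ?_)
      fun h => key _ (((hP _).trans (hP d)).trans hde) ?_)
    · rw [h, R.fst_faceNext]
    · rw [h, R.fst_faceNext]
  refine ⟨⟨fun u => a (φ u), fun d => if P d then S else S', ha.comp φ.injective, ?_, ?_, ?_, ?_,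
    fun u w h => hadj _ _ (φ.injective.ne h.ne)⟩⟩
  · intro d
    simp only [hP]
  · intro d e hde
    by_cases h1 : P d <;> by_cases h2 : P e
    · exact absurd (hcyc d e (by simp [h1, h2])) hde
    · simpa [h1, h2] using hd
    · simpa [h1, h2] using hd.symm
    · exact absurd (hcyc d e (by simp [h1, h2])) hde
  · intro u d
    split_ifs
    · exact hn _
    · exact hn' _
  · intro d
    obtain ⟨h1, h2, h3⟩ := hne d
    split_ifs
    · exact hS.of_ne h1 h2 h3
    · exact hS'.of_ne h1 h2 h3

/-- Deleting a vertex of degree three merges the three faces around it, and changes no other. -/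
theorem exists_delete_degree_three {V : Type u} [Finite V] {G : SimpleGraph V}
    {R : RotationSystem G} (hR : R.IsTriangulated) {v : V} (hv : (G.neighborSet v).ncard = 3) :
    ∃ (R' : RotationSystem (G.induce ({v}ᶜ : Set V))) (a b c : V) (ha : G.Adj v a)
      (hb : G.Adj v b) (hc : G.Adj v c) (d : (G.induce ({v}ᶜ : Set V)).Dart),
      R'.IsTriangulated ∧ a ≠ b ∧ b ≠ c ∧ c ≠ a ∧ (∀ x, G.Adj v x → x = a ∨ x = b ∨ x = c) ∧
      (R.faceNext ⟨(v, a), ha⟩).snd = c ∧ (R.faceNext ⟨(v, b), hb⟩).snd = a ∧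
      (R.faceNext ⟨(v, c), hc⟩).snd = b ∧
      (d.fst : V) = b ∧ (d.snd : V) = a ∧ ((R'.faceNext d).snd : V) = c ∧
      (∀ e, (R.faceNext (ofDelete e)).snd = v ↔ R'.faceNext.SameCycle d e) ∧
      ∀ e, (R.faceNext (ofDelete e)).snd ≠ v →
        ofDelete (R'.faceNext e) = R.faceNext (ofDelete e) := by
  obtain ⟨a, b, c, ha, hb, hc, hab, hbc, hca, hall, nab, nbc, nca⟩ := R.exists_neighbors hv
  obtain ⟨R', h1, h2⟩ := hR.exists_delete v
  obtain ⟨hba, -, ab2, ab3⟩ := hR.faceNext_of_next ha hb nab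
  obtain ⟨hcb, -, bc2, bc3⟩ := hR.faceNext_of_next hb hc nbc
  obtain ⟨hac, -, ca2, ca3⟩ := hR.faceNext_of_next hc ha nca
  obtain ⟨d, hd⟩ := exists_ofDelete_eq (v := v) (d := ⟨(b, a), hba⟩) hb.ne' ha.ne'
  obtain ⟨d', hd'⟩ := exists_ofDelete_eq (v := v) (d := ⟨(a, c), hac⟩) ha.ne' hc.ne'
  obtain ⟨d'', hd''⟩ := exists_ofDelete_eq (v := v) (d := ⟨(c, b), hcb⟩) hc.ne' hb.ne'
  -- The outer darts `b → a → c → b` of the three faces at `v` become one new triangular face.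
  have hdd' : R'.faceNext d = d' := by
    apply ofDelete_injective
    rw [h2 d (by rw [hd, ab3]), hd, ab3, hd']
    exact ca2
  have hdd'' : R'.faceNext d' = d'' := by
    apply ofDelete_injective
    rw [h2 d' (by rw [hd', ca3]), hd', ca3, hd'']
    exact bc2
  have hdd : R'.faceNext d'' = d := by
    apply ofDelete_injective
    rw [h2 d'' (by rw [hd'', bc3]), hd'', bc3, hd]
    exact ab2
  have hspec : ∀ e, (R.faceNext (ofDelete e)).snd = v → e = d ∨ e = d' ∨ e = d'' := by
    intro e he
    have h3 := R.fst_faceNext (ofDelete e)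
    have h4 : G.Adj v (ofDelete e).snd := by
      have := (R.faceNext (ofDelete e)).adj
      rw [h3, he] at this
      exact this.symm
    rcases hall _ h4 with h | h | h
    · left
      apply ofDelete_injective
      apply R.faceNext.injective
      rw [hd, ab3]
      exact Dart.ext' (h3.trans h) he
    · right; right
      apply ofDelete_injective
      apply R.faceNext.injective
      rw [hd'', bc3]
      exact Dart.ext' (h3.trans h) he
    · right; left
      apply ofDelete_injective
      apply R.faceNext.injective
      rw [hd', ca3]
      exact Dart.ext' (h3.trans h) he
  have hspec' : ∀ e, (R.faceNext (ofDelete e)).snd = v ↔ e = d ∨ e = d' ∨ e = d'' := by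
    refine fun e => ⟨hspec e, ?_⟩
    rintro (rfl | rfl | rfl)
    · rw [hd, ab3]
    · rw [hd', ca3]
    · rw [hd'', bc3]
  have hR' : R'.IsTriangulated := by
    apply isTriangulated_of_faceNext
    intro e
    by_cases he : e = d ∨ e = d' ∨ e = d''
    · rcases he with rfl | rfl | rfl
      · rw [hdd', hdd'', hdd]
      · rw [hdd'', hdd, hdd']
      · rw [hdd, hdd', hdd'']
    · have hnext : ∀ e, ¬ (e = d ∨ e = d' ∨ e = d'') →
          ¬ (R'.faceNext e = d ∨ R'.faceNext e = d' ∨ R'.faceNext e = d'') := by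
        intro e he
        have := R'.faceNext.injective
        rw [← hdd', ← hdd'', ← hdd, hdd'] at *
        grind
      have hstep : ∀ e, ¬ (e = d ∨ e = d' ∨ e = d'') →
          ofDelete (R'.faceNext e) = R.faceNext (ofDelete e) :=
        fun e he => h1 e fun h => he (hspec e h)
      apply ofDelete_injective
      rw [hstep _ (hnext _ (hnext _ he)), hstep _ (hnext _ he), hstep _ he,
        hR.faceNext_faceNext_faceNext]
  refine ⟨R', a, b, c, ha, hb, hc, d, hR', hab, hbc, hca, hall, ?_, ?_, ?_,
    congrArg (fun d : G.Dart => d.fst) hd, congrArg (fun d : G.Dart => d.snd) hd, ?_, ?_, h1⟩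
  · rw [ca2]
  · rw [ab2]
  · rw [bc2]
  · rw [hdd']
    exact congrArg (fun d : G.Dart => d.snd) hd'
  · intro e
    rw [hspec', hR'.sameCycle, hdd', hdd'']

/-- The face left behind by `v` has a region, which splits at a new code for `v`. The three parts go
to the faces at `v`; all other faces keep their regions. -/
theorem nonempty_stacking_step {V : Type u} [Finite V] {G : SimpleGraph V}
    {R : RotationSystem G} (hR : R.IsTriangulated) {v : V} (hv : (G.neighborSet v).ncard = 3)
    (ih : ∀ R' : RotationSystem (G.induce ({v}ᶜ : Set V)), R'.IsTriangulated →
      Nonempty (Stacking R')) : Nonempty (Stacking R) := by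
  classical
  obtain ⟨R', a, b, c, ha, hb, hc, d₀, hR', hab, hbc, hca, hall, na, nb, nc, db, da, dc, hspec,
    hother⟩ := exists_delete_degree_three hR hv
  obtain ⟨s⟩ := ih R' hR'
  -- The value at `v` is a dummy; the code of `v` comes from the split.
  let φ : V → Code := fun u => if h : u = v then [] else s.code ⟨u, h⟩
  have hφ : ∀ u : ({v}ᶜ : Set V), s.code u = φ u := by
    intro u
    simp only [φ]
    rw [dif_neg (show (u : V) ≠ v from u.2)]
  have hsplit := (s.isRegion d₀).splits
  rw [hφ, hφ, hφ, db, da, dc] at hsplit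
  obtain ⟨n, hn, S₁, S₂, S₃, ⟨r1, r2, r3⟩, ⟨s1, s2, s3⟩, ⟨n1, n2, n3⟩, ⟨d1, d2, d3⟩,
    ab, aa, ac⟩ := hsplit
  let code : V → Code := fun u => if u = v then n else φ u
  have codev : code v = n := if_pos rfl
  have code_ne : ∀ {u}, u ≠ v → code u = φ u := fun h => if_neg h
  have code_coe : ∀ u : ({v}ᶜ : Set V), code u = s.code u :=
    fun u => (code_ne u.2).trans (hφ u).symm
  -- A face at `v` is named by the end `x` of its dart from `v`. The faces of `a`, `b`, `c` have
  -- third corners `c`, `a`, `b`, which determines the parts `S₁`, `S₃`, `S₂`.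
  let T : V → Set Code := fun x => if x = a then S₁ else if x = b then S₃ else S₂
  have Ta : T a = S₁ := if_pos rfl
  have Tb : T b = S₃ := by simp [T, hab.symm]
  have Tc : T c = S₂ := by simp [T, hca, hbc.symm]
  have T_sub : ∀ x, T x ⊆ s.region d₀ := by
    intro x; simp only [T]; split_ifs <;> assumption
  have T_n : ∀ x, n ∉ T x := by
    intro x; simp only [T]; split_ifs <;> assumption
  have T_disj : ∀ x y, G.Adj v x → G.Adj v y → x ≠ y → Disjoint (T x) (T y) := by
    intro x y hx hy hxy
    rcases hall x hx with rfl | rfl | rfl <;> rcases hall y hy with rfl | rfl | rfl <;>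
      simp only [Ta, Tb, Tc] <;> first
      | exact absurd rfl hxy
      | assumption
      | (apply Disjoint.symm; assumption)
  -- The three tests locate `v` on the face of `d`. The default `∅` is never taken, since a dart
  -- avoiding `v` comes from the smaller graph.
  let region : G.Dart → Set Code := fun d =>
    if d.fst = v then T d.snd else if d.snd = v then T (R.faceNext d).snd
    else if (R.faceNext d).snd = v then T d.fst
    else Function.extend ofDelete s.region (fun _ => ∅) d
  -- the darts of the faces at `v`, and the other darts
  have cases : ∀ d : G.Dart, (∃ x, ∃ hx : G.Adj v x, R.faceNext.SameCycle ⟨(v, x), hx⟩ d) ∨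
      ∃ e : (G.induce ({v}ᶜ : Set V)).Dart, ofDelete e = d ∧ (R.faceNext d).snd ≠ v := by
    have start : ∀ d : G.Dart, d.fst = v → ∃ x, ∃ hx : G.Adj v x, ⟨(v, x), hx⟩ = d := by
      intro d hd
      exact ⟨d.snd, hd ▸ d.adj, Dart.ext' hd.symm rfl⟩
    intro d
    by_cases h1 : d.fst = v
    · obtain ⟨x, hx, he⟩ := start d h1
      exact Or.inl ⟨x, hx, he ▸ .refl _ _⟩
    by_cases h2 : d.snd = v
    · obtain ⟨x, hx, he⟩ := start (R.faceNext d) ((R.fst_faceNext d).trans h2)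
      exact Or.inl ⟨x, hx, he ▸ (hR.sameCycle.2 (Or.inr (Or.inl rfl))).symm⟩
    by_cases h3 : (R.faceNext d).snd = v
    · obtain ⟨x, hx, he⟩ := start (R.faceNext (R.faceNext d)) ((R.fst_faceNext _).trans h3)
      exact Or.inl ⟨x, hx, he ▸ (hR.sameCycle.2 (Or.inr (Or.inr rfl))).symm⟩
    · obtain ⟨e, he⟩ := exists_ofDelete_eq h1 h2
      exact Or.inr ⟨e, he, h3⟩
  have region_T : ∀ (d : G.Dart) (x : V) (hx : G.Adj v x),
      R.faceNext.SameCycle ⟨(v, x), hx⟩ d → region d = T x := by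
    intro d x hx hd
    rcases hR.sameCycle.1 hd with rfl | rfl | rfl
    · exact if_pos rfl
    · have h1 : (R.faceNext ⟨(v, x), hx⟩).fst = x := R.fst_faceNext _
      have h2 : (R.faceNext (R.faceNext ⟨(v, x), hx⟩)).snd = v := hR.snd_faceNext_faceNext _
      have h3 : (R.faceNext ⟨(v, x), hx⟩).snd ≠ v := fun h =>
        Dart.fst_ne_snd _ (((R.fst_faceNext _).trans h).trans h2.symm)
      simp only [region]
      rw [if_neg (fun h => hx.ne' (h1.symm.trans h)), if_neg h3, if_pos h2, h1]
    · have h2 : (R.faceNext (R.faceNext ⟨(v, x), hx⟩)).snd = v := hR.snd_faceNext_faceNext _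
      simp only [region]
      rw [if_neg (fun h => Dart.fst_ne_snd _ (h.trans h2.symm)), if_pos h2,
        hR.faceNext_faceNext_faceNext]
  have region_old : ∀ e, (R.faceNext (ofDelete e)).snd ≠ v →
      region (ofDelete e) = s.region e := by
    intro e he
    simp only [region]
    rw [if_neg (fst_ofDelete_ne e), if_neg (snd_ofDelete_ne e), if_neg he,
      ofDelete_injective.extend_apply]
  have old_next : ∀ e, (R.faceNext (ofDelete e)).snd ≠ v →
      (R.faceNext (ofDelete (R'.faceNext e))).snd ≠ v := by
    intro e he
    rw [hother e he, hR.snd_faceNext_faceNext]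
    exact fst_ofDelete_ne e
  have old_disj : ∀ e, (R.faceNext (ofDelete e)).snd ≠ v →
      Disjoint (s.region d₀) (s.region e) :=
    fun e he => s.disjoint _ _ fun h => he ((hspec e).2 h)
  have isRegion_rot : ∀ d, IsRegion (code d.fst) (code d.snd) (code (R.faceNext d).snd) (T d.snd) →
      ∀ e, R.faceNext.SameCycle d e →
        IsRegion (code e.fst) (code e.snd) (code (R.faceNext e).snd) (T d.snd) := by
    intro d hd e he
    rcases hR.sameCycle.1 he with rfl | rfl | rfl
    · exact hd
    · rw [R.fst_faceNext, hR.snd_faceNext_faceNext]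
      exact hd.rot
    · rw [R.fst_faceNext, hR.snd_faceNext_faceNext, hR.faceNext_faceNext_faceNext]
      exact hd.rot.rot
  refine ⟨⟨code, region, ?_, ?_, ?_, ?_, ?_, ?_⟩⟩
  · have hne : ∀ u, u ≠ v → code u ≠ n := by
      intro u hu h
      rw [code_coe ⟨u, hu⟩] at h
      exact s.notMem_region _ _ (h ▸ hn)
    intro u w huw
    by_cases hu : u = v <;> by_cases hw : w = v
    · rw [hu, hw]
    · rw [hu, codev] at huw
      exact absurd huw.symm (hne w hw)
    · rw [hw, codev] at huw
      exact absurd huw (hne u hu)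
    · rw [code_coe ⟨u, hu⟩, code_coe ⟨w, hw⟩] at huw
      exact congrArg Subtype.val (s.code_injective huw)
  · intro d
    rcases cases d with ⟨x, hx, hd⟩ | ⟨e, rfl, he⟩
    · rw [region_T _ x hx hd,
        region_T _ x hx (hd.trans (hR.sameCycle.2 (Or.inr (Or.inl rfl))))]
    · rw [← hother e he, region_old _ he, region_old _ (old_next e he), s.region_faceNext]
  · intro d e hde
    rcases cases d with ⟨x, hx, hd⟩ | ⟨d, rfl, hd⟩ <;> rcases cases e with ⟨y, hy, he⟩ | ⟨e, rfl, he⟩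
    · rw [region_T _ x hx hd, region_T _ y hy he]
      refine T_disj x y hx hy ?_
      rintro rfl
      exact hde (hd.symm.trans he)
    · rw [region_T _ x hx hd, region_old _ he]
      exact (old_disj e he).mono_left (T_sub x)
    · rw [region_T _ y hy he, region_old _ hd]
      exact ((old_disj d hd).mono_left (T_sub y)).symm
    · rw [region_old _ hd, region_old _ he]
      refine s.disjoint _ _ fun h => hde ?_
      rw [hR.sameCycle]
      rcases hR'.sameCycle.1 h with rfl | rfl | rfl
      · exact Or.inl rfl
      · exact Or.inr (Or.inl (hother _ hd))
      · refine Or.inr (Or.inr ?_)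
        rw [hother _ (old_next d hd), hother _ hd]
  · intro u d
    rcases cases d with ⟨x, hx, hd⟩ | ⟨e, rfl, he⟩
    · rw [region_T _ x hx hd]
      by_cases hu : u = v
      · rw [hu, codev]
        exact T_n x
      · rw [code_coe ⟨u, hu⟩]
        exact fun h => s.notMem_region _ _ (T_sub x h)
    · rw [region_old _ he]
      by_cases hu : u = v
      · rw [hu, codev]
        exact Set.disjoint_left.1 (old_disj e he) hn
      · rw [code_coe ⟨u, hu⟩]
        exact s.notMem_region _ _
  · intro d
    rcases cases d with ⟨x, hx, hd⟩ | ⟨e, rfl, he⟩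
    · rw [region_T _ x hx hd]
      refine isRegion_rot ⟨(v, x), hx⟩ ?_ d hd
      rcases hall x hx with rfl | rfl | rfl
      · rw [na, Ta]
        simp only [codev, code_ne ha.ne', code_ne hc.ne']
        exact r1
      · rw [nb, Tb]
        simp only [codev, code_ne ha.ne', code_ne hb.ne']
        exact r3.rot.rot
      · rw [nc, Tc]
        simp only [codev, code_ne hb.ne', code_ne hc.ne']
        exact r2.rot
    · rw [region_old _ he, ← hother e he]
      have := s.isRegion e
      rw [← code_coe, ← code_coe, ← code_coe] at this
      exact this
  · have hadj : ∀ x, G.Adj v x → CodeAdj n (code x) := by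
      intro x hx
      rw [code_ne hx.ne']
      rcases hall x hx with rfl | rfl | rfl <;> assumption
    intro u w huw
    by_cases hu : u = v
    · subst hu
      rw [codev]
      exact hadj w huw
    by_cases hw : w = v
    · subst hw
      rw [codev]
      exact (hadj u huw.symm).symm
    · rw [code_coe ⟨u, hu⟩, code_coe ⟨w, hw⟩]
      exact s.codeAdj _ _ huw

/-- The induction runs over all triangulated rotation systems: the one left by a deletion need not
be the one that witnesses that the smaller graph is a plane triangulation. Planarity enters only
through the degree of `v`. -/
theorem nonempty_stacking {V : Type u} {G : SimpleGraph V} (hG : G.IsPlanarThreeTree)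
    (R : RotationSystem G) (hR : R.IsTriangulated) : Nonempty (Stacking R) := by
  induction hG with
  | triangle G h3 _ => exact nonempty_stacking_triangle h3 hR
  | step G hlt ht v hd ih =>
    have hG : G.IsPlanarThreeTree := .step G hlt ht v hd
    have := hG.finite
    exact nonempty_stacking_step hR (hG.ncard_neighborSet hd) ih

/-! ### From codes to a queue layout -/

/-- A graph has a queue layout with five queues if its vertices have suitable codes. -/
noncomputable def queueLayout {V : Type u} {G : SimpleGraph V} (code : V → Code)
    (hc : Function.Injective code) (h : ∀ u w, G.Adj u w → CodeAdj (code u) (code w)) :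
    QueueLayout G 5 :=
  have hq : ∀ e : G.edgeSet, ∃ q, ∃ u w, (e : Sym2 V) = s(u, w) ∧ InQueue q (code u) (code w) := by
    rintro ⟨e, he⟩
    induction e using Sym2.ind with
    | _ u w =>
      obtain ⟨q, hq | hq⟩ := h u w he
      · exact ⟨q, u, w, rfl, hq⟩
      · exact ⟨q, w, u, Sym2.eq_swap, hq⟩
  { order := LinearOrder.lift' (fun v => rank (code v)) (rank_injective.comp hc)
    queue := fun e => finSumFinEquiv (m := 2) (n := 3) (hq e).choose
    not_nested := by
      intro a b c d hab hcd h1 h2 h3 heq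
      have h1' : rank (code a) < rank (code c) := h1
      have h2' : rank (code c) < rank (code d) := h2
      have h3' : rank (code d) < rank (code b) := h3
      -- The ends chosen for an edge may come in either order, but edges of queues point upwards in
      -- rank, so they agree with the order at hand.
      have key : ∀ (x y : V) (hxy : G.Adj x y), rank (code x) < rank (code y) →
          InQueue (hq ⟨s(x, y), hxy⟩).choose (code x) (code y) := by
        intro x y hxy hlt
        obtain ⟨u, w, he, hi⟩ := (hq ⟨s(x, y), hxy⟩).choose_spec
        rcases Sym2.eq_iff.1 he with ⟨rfl, rfl⟩ | ⟨rfl, rfl⟩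
        · exact hi
        · exact absurd hi.rank_lt hlt.asymm
      have hb := key a b hab (h1'.trans (h2'.trans h3'))
      have hd := key c d hcd h2'
      rw [← finSumFinEquiv.injective heq] at hd
      exact hb.not_nested hd h1' h3' }

end ThreeTree

end SimpleGraph

theorem mainTheorem1 {V : Type u} (G : SimpleGraph V) (hG : G.IsPlanarThreeTree) :
    G.queueNumber ≤ 5 := by
  suffices h : ∃ code : V → SimpleGraph.ThreeTree.Code, Function.Injective code ∧
      ∀ u w, G.Adj u w → SimpleGraph.ThreeTree.CodeAdj (code u) (code w) by
    obtain ⟨code, hc, h⟩ := h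
    exact iInf₂_le 5 ⟨SimpleGraph.ThreeTree.queueLayout code hc h⟩
  have hG' := hG
  cases hG with
  | triangle _ h3 _ =>
    -- The 3-cycle comes without a rotation system, so the corners of the initial triangle serve
    -- directly as codes.
    have : Finite V := hG'.finite
    obtain ⟨a, -, -, ha, -, -, -, -, -, hadj⟩ := SimpleGraph.ThreeTree.exists_initial_triangle
    let φ : V ≃ Fin 3 := Finite.equivFinOfCardEq h3
    exact ⟨fun u => a (φ u), ha.comp φ.injective, fun u w h => hadj _ _ (φ.injective.ne h.ne)⟩
  | step _ _ ht =>
    obtain ⟨-, R, -, hR⟩ := ht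
    obtain ⟨s⟩ := SimpleGraph.ThreeTree.nonempty_stacking hG' R hR
    exact ⟨s.code, s.code_injective, s.codeAdj⟩
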